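/- **Lions and contamination.** Let $G=(V,E)$ be a finite simple graph. A strategy with $k$ lions places $k$ lions on vertices (several may share a vertex); in each time step every lion stays or moves along an edge. Let $L_t$ be the set of vertices occupied at time $t$ and $\pi_t$ the set of pairs $(u,v)$ such that some lion moves from $u$ to $v$ in step $t$. The contaminated sets are $W_0=V\setminus L_0$ and, for $t\ge 1$, $$W_t=(W_{t-1}\setminus L_t)\cup\{v\in V\setminus L_t : \exists\, w\in W_{t-1},\ \{v,w\}\in E,\ (v,w)\notin\pi_t,\ (w,v)\notin\pi_t\}.$$ The strategy clears $G$ if $W_t=\emptyset$ for some $t\ge 0$. The lion number $\mathcal L(G)$ is the least $k$ such that some strategy with $k$ lions clears $G$. **The graphs.** Let $t_1=1$ and $t_{i+1}=4t_i+15$ for $i\ge 1$. Let $T_1$ be the tree consisting of a root and two leaves adjacent to it. For $i\ge 1$ let $T_{i+1}$ consist of a new root and two disjoint copies of $T_i$, where the new root is joined to the root of each copy by a path with $t_i+5$ internal vertices. Let $G_i$ be obtained from $T_i$ by adding one vertex adjacent to all vertices of $T_i$. **Theorem.** The lion number is not monotone under subgraph inclusion: it is not true that $\mathcal L(H)\le\mathcal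 L(G)$ for every finite graph $G$ and every subgraph $H$ of $G$. More precisely: 1. for every $i\ge 1$, $T_i$ is a tree, $T_i$ is isomorphic to a subgraph of $G_i$, $\mathcal L(G_i)\le 3$, and $\mathcal L(T_i)\ge\lceil i/2\rceil$; 2. for every $i\ge 2$, $\mathcal L(G_i)=3$; 3. for every $i>6$, $\mathcal L(G_i)=3<\mathcal L(T_i)$. -/

import Mathlib

/-- The trajectories of `k` lions on the graph `G`: in every time step each lion stays where it is
or moves along an edge. Several lions may be on the same vertex. -/
structure LionPath {V : Type*} (G : SimpleGraph V) (k : ℕ) where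
  pos : ℕ → Fin k → V
  step : ∀ t j, pos (t + 1) j = pos t j ∨ G.Adj (pos t j) (pos (t + 1) j)

namespace LionPath

variable {V : Type*} {G : SimpleGraph V} {k : ℕ}

/-- The set of vertices occupied by lions at time `t`. -/
def occupied (p : LionPath G k) (t : ℕ) : Set V := Set.range (p.pos t)

/-- The set of pairs `(u, v)` such that some lion moves from `u` to `v` between the times `t`
and `t + 1`. -/
def moves (p : LionPath G k) (t : ℕ) : Set (V × V) :=
  Set.range fun j => (p.pos t j, p.pos (t + 1) j)

/-- The set of contaminated vertices at time `t`. Initially this is every vertex without a lion.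
In each step the vertices that get occupied are cleared, and an unoccupied vertex becomes
contaminated when it has a contaminated neighbour and no lion moves along the joining edge. -/
def contaminated (p : LionPath G k) : ℕ → Set V
  | 0 => (p.occupied 0)ᶜ
  | t + 1 =>
      (p.contaminated t \ p.occupied (t + 1)) ∪
        {v | v ∉ p.occupied (t + 1) ∧
          ∃ w ∈ p.contaminated t, G.Adj v w ∧ (v, w) ∉ p.moves t ∧ (w, v) ∉ p.moves t}

end LionPath

/-- `k` lions can clear the graph `G`. -/
def LionClearable {V : Type*} (G : SimpleGraph V) (k : ℕ) : Prop :=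
  ∃ (p : LionPath G k) (t : ℕ), p.contaminated t = ∅

/-- The lion number: the least number of lions that can clear `G`. -/
noncomputable def lionNumber {V : Type*} (G : SimpleGraph V) : ℕ :=
  sInf {k | LionClearable G k}

/-- One lion on each vertex clears a finite graph, so for finite graphs the set of which
`lionNumber` is the infimum is nonempty, and the lion number is a minimum. -/
theorem lionClearable_card {V : Type*} [Finite V] (G : SimpleGraph V) :
    LionClearable G (Nat.card V) := by
  refine ⟨⟨fun _ => (Finite.equivFin V).symm, fun _ _ => Or.inl rfl⟩, 0, ?_⟩
  simp [LionPath.contaminated, LionPath.occupied]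

theorem lionClearable_lionNumber {V : Type*} [Finite V] (G : SimpleGraph V) :
    LionClearable G (lionNumber G) :=
  Nat.sInf_mem (s := {k | LionClearable G k}) ⟨_, lionClearable_card G⟩

/-- The graph obtained from `G` by adding one new vertex, `none`, adjacent to all vertices. -/
def addUniversal {V : Type*} (G : SimpleGraph V) : SimpleGraph (Option V) where
  Adj
    | none, none => False
    | none, some _ => True
    | some _, none => True
    | some a, some b => G.Adj a b
  symm := ⟨by
    rintro (_ | a) (_ | b) h
    · exact h
    · trivial
    · trivial
    · exact G.adj_symm h⟩
  loopless := ⟨by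
    rintro (_ | a) h
    · exact h
    · exact G.loopless.irrefl a h⟩

/-- Vertices of the graph made of a new root (`none`), two copies (indexed by `Bool`) of a graph
with vertex set `V`, and, for each copy, a path of `l` internal vertices joining the new root to
it. The internal vertex `j : Fin l` has distance `j + 1` from the new root. -/
abbrev JoinVertex (V : Type) (l : ℕ) : Type := Option (Bool × (V ⊕ Fin l))

/-- The edges of that graph, each in the direction away from the new root on the two paths; `r` is
the root of `G`, at which the paths end. For `l = 0` the new root is adjacent to the roots of the
two copies. -/
def joinRel {V : Type} (G : SimpleGraph V) (r : V) (l : ℕ) :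
    JoinVertex V l → JoinVertex V l → Prop
  | none, some (_, Sum.inr j) => (j : ℕ) = 0
  | none, some (_, Sum.inl v) => l = 0 ∧ v = r
  | some (b, Sum.inr j), some (b', Sum.inr j') => b = b' ∧ (j : ℕ) + 1 = j'
  | some (b, Sum.inr j), some (b', Sum.inl v) => b = b' ∧ (j : ℕ) + 1 = l ∧ v = r
  | some (b, Sum.inl v), some (b', Sum.inl v') => b = b' ∧ G.Adj v v'
  | _, _ => False

/-- A new root joined to the roots of two disjoint copies of `G` by paths with `l` internal
vertices. -/
def joinTwoCopies {V : Type} (G : SimpleGraph V) (r : V) (l : ℕ) :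
    SimpleGraph (JoinVertex V l) :=
  SimpleGraph.fromRel (joinRel G r l)

/-- `t₁ = 1` and `tᵢ₊₁ = 4 tᵢ + 15`. The value at `0` is not used. -/
def stepCount : ℕ → ℕ
  | 0 => 0
  | 1 => 1
  | n + 2 => 4 * stepCount (n + 1) + 15

/-- The number of internal vertices of the two paths from the root of `Tₙ₊₁` to the two copies of
`Tₙ`: it is `tₙ + 5` for `n ≥ 1`. With `T₀` a single vertex and no internal vertices for `n = 0`,
the tree `T₁` is a root with two leaves. -/
def internalCount : ℕ → ℕ
  | 0 => 0
  | n + 1 => stepCount (n + 1) + 5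

/-- The vertices of the tree `Tₙ`. -/
def TreeVertex : ℕ → Type
  | 0 => Unit
  | n + 1 => JoinVertex (TreeVertex n) (internalCount n)

/-- The root of `Tₙ`. -/
def treeRoot : (n : ℕ) → TreeVertex n
  | 0 => ()
  | _ + 1 => (none : Option _)

/-- The recursively subdivided binary tree `Tₙ`. -/
def subdividedTree : (n : ℕ) → SimpleGraph (TreeVertex n)
  | 0 => (⊥ : SimpleGraph Unit)
  | n + 1 => joinTwoCopies (subdividedTree n) (treeRoot n) (internalCount n)

instance finite_treeVertex (n : ℕ) : Finite (TreeVertex n) := by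
  induction n with
  | zero => exact inferInstanceAs (Finite Unit)
  | succ n ih => exact inferInstanceAs (Finite (Option (Bool × (TreeVertex n ⊕ Fin _))))

/-- The graph `Gₙ`: the tree `Tₙ` with a universal vertex added. -/
def universalTree (n : ℕ) : SimpleGraph (Option (TreeVertex n)) :=
  addUniversal (subdividedTree n)

/-! The lower bound for the trees and the upper bound for the graphs with a universal vertex are
independent.

Lower bound. A copy of `Tᵢ₊₁` in `Tᵢ₊₂` has a root `x` with three branches, each of which retracts
onto `Tᵢ`. If `k` lions cannot clear `Tᵢ`, then `k + 1` lions cannot clear `Tᵢ₊₂`. Indeed, while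
some lion is outside a branch, the lions act on it like `k` lions
(`exists_dominating_of_exists_notMem`), so it can only be cleared while all lions are inside. When
they later gather in another branch, the third branch is contaminated and unguarded; its
contamination reaches `x` and then reenters the branch that was left. This reentry starts at a
single vertex, but contamination travels as fast as lions, so it is as good as a fully contaminated
branch (`exists_contaminated_of_gate`). `ThreeBranches.not_lionClearable_succ` turns this into an
invariant; hence two levels of the tree cost one more lion.

Upper bound. A lion waiting on the universal vertex lets either of the other two jump anywhere, by
exchanging roles (`lionClearable_addUniversal_of_seq`). So it suffices to sweep `Tᵢ` by two lions,
one of which may jump in each step. In the recursion `Sweep.join` the paths are at least as long as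
the time a copy takes, so while the first copy is swept, the contamination coming from the second
one does not reach the new root.

Two lions do not suffice for `i ≥ 2`: `Tᵢ` then retracts onto a claw, and the claw with a universal
vertex already defeats two lions. -/

namespace LionPath

/-! ### Comparing lion paths on different graphs -/

variable {V W : Type*} {G : SimpleGraph V} {H : SimpleGraph W} {k m : ℕ}

theorem notMem_occupied_of_mem_contaminated (p : LionPath G k) {t : ℕ} {v : V}
    (h : v ∈ p.contaminated t) : v ∉ p.occupied t := by
  cases t with
  | zero => exact h
  | succ t =>
    rcases h with h | h
    · exact h.2
    · exact h.1

theorem mem_contaminated_stay (p : LionPath G k) {t : ℕ} {v : V}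
    (h : v ∈ p.contaminated t) (ho : v ∉ p.occupied (t + 1)) : v ∈ p.contaminated (t + 1) :=
  Or.inl ⟨h, ho⟩

theorem mem_contaminated_spread (p : LionPath G k) {t : ℕ} {v w : V}
    (h : w ∈ p.contaminated t) (hvw : G.Adj v w) (ho : v ∉ p.occupied (t + 1))
    (h₁ : (v, w) ∉ p.moves t) (h₂ : (w, v) ∉ p.moves t) : v ∈ p.contaminated (t + 1) :=
  Or.inr ⟨ho, w, h, hvw, h₁, h₂⟩

theorem exists_of_mem_contaminated_succ (p : LionPath G k) {t : ℕ} {v : V}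
    (h : v ∈ p.contaminated (t + 1)) :
    v ∈ p.contaminated t ∨
      ∃ w ∈ p.contaminated t, G.Adj v w ∧ (v, w) ∉ p.moves t ∧ (w, v) ∉ p.moves t := by
  rcases h with h | h
  · exact Or.inl h.1
  · exact Or.inr h.2

theorem left_mem_occupied_of_mem_moves (p : LionPath G k) {t : ℕ} {v w : V}
    (h : (v, w) ∈ p.moves t) : v ∈ p.occupied t := by
  obtain ⟨j, hj⟩ := h
  exact ⟨j, congrArg Prod.fst hj⟩

theorem right_mem_occupied_of_mem_moves (p : LionPath G k) {t : ℕ} {v w : V}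
    (h : (v, w) ∈ p.moves t) : w ∈ p.occupied (t + 1) := by
  obtain ⟨j, hj⟩ := h
  exact ⟨j, congrArg Prod.snd hj⟩

/-- If the lions of `q` control everything that the lions of `p` control on the image of `f`, then
`f` maps contaminated vertices to contaminated vertices. -/
theorem mem_contaminated_of_dominated (p : LionPath G m) (q : LionPath H k) (f : W → V)
    (hf : ∀ a b, H.Adj a b → G.Adj (f a) (f b)) (t : ℕ)
    (ho : ∀ s ≤ t, ∀ w, f w ∈ p.occupied s → w ∈ q.occupied s)
    (hm : ∀ s < t, ∀ v w, (f v, f w) ∈ p.moves s → (v, w) ∈ q.moves s) :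
    ∀ w ∈ q.contaminated t, f w ∈ p.contaminated t := by
  induction t with
  | zero => exact fun w hw h => hw (ho 0 le_rfl w h)
  | succ t ih =>
    have ih' := ih (fun s hs => ho s (by omega)) (fun s hs => hm s (by omega))
    intro w hw
    have hw' : f w ∉ p.occupied (t + 1) := fun h =>
      q.notMem_occupied_of_mem_contaminated hw (ho _ le_rfl w h)
    rcases q.exists_of_mem_contaminated_succ hw with h | ⟨v, hv, hwv, h₁, h₂⟩
    · exact p.mem_contaminated_stay (ih' w h) hw'
    · exact p.mem_contaminated_spread (ih' v hv) (hf _ _ hwv) hw'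
        (fun h => h₁ (hm t (by omega) _ _ h)) (fun h => h₂ (hm t (by omega) _ _ h))

/-- The image of a lion path under a map that sends edges to edges or vertices. -/
def map (p : LionPath G k) (g : V → W) (hg : ∀ a b, G.Adj a b → g b = g a ∨ H.Adj (g a) (g b)) :
    LionPath H k where
  pos t j := g (p.pos t j)
  step t j := by
    rcases p.step t j with h | h
    · exact Or.inl (congrArg g h)
    · exact hg _ _ h

/-- The lion path that starts at time `s` of `p` and stops after `n` steps. -/
def slice (p : LionPath G k) (s n : ℕ) : LionPath G k where
  pos t j := p.pos (s + min t n) j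
  step t j := by
    rcases lt_or_ge t n with h | h
    · rw [min_eq_left h.le, min_eq_left (by omega : t + 1 ≤ n), ← add_assoc]
      exact p.step _ j
    · rw [min_eq_right h, min_eq_right (by omega : n ≤ t + 1)]
      exact Or.inl rfl

theorem slice_occupied (p : LionPath G k) {s n t : ℕ} (h : t ≤ n) :
    (p.slice s n).occupied t = p.occupied (s + t) := by
  simp [occupied, slice, min_eq_left h]

theorem slice_moves (p : LionPath G k) {s n t : ℕ} (h : t < n) :
    (p.slice s n).moves t = p.moves (s + t) := by
  simp [moves, slice, min_eq_left h.le, min_eq_left (by omega : t + 1 ≤ n), add_assoc]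

/-- If one of `k + 1` lions is always outside `X`, then `k` lions suffice to do in `X` what these
lions do. Here `a` is the only vertex of `X` that may have neighbours outside `X`, and `H` is a retract
of `G` contained in `X`. -/
theorem exists_dominating_of_exists_notMem (p : LionPath G (k + 1)) {X : Set V} {a : V}
    (ha : ∀ v ∈ X, ∀ w ∉ X, G.Adj v w → v = a)
    (hp : ∀ s, ∃ j, p.pos s j ∉ X) (f : W → V) (g : V → W) (hfX : ∀ w, f w ∈ X)
    (hg : ∀ a b, G.Adj a b → g b = g a ∨ H.Adj (g a) (g b)) (hgf : ∀ w, g (f w) = w) :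
    ∃ q : LionPath H k, (∀ s w, f w ∈ p.occupied s → w ∈ q.occupied s) ∧
      ∀ s v w, (f v, f w) ∈ p.moves s → (v, w) ∈ q.moves s := by
  classical
  choose j hj using hp
  -- The lion outside `X` may change with time, so the lions are relabelled: `σ t` gives the last
  -- label to `j t`, and the other `k` labels are the lions of `q`.
  let σ : ℕ → Equiv.Perm (Fin (k + 1)) := fun t =>
    Nat.rec (Equiv.swap (Fin.last k) (j 0)) (fun t e => Equiv.swap (j t) (j (t + 1)) * e) t
  have hσ : ∀ t, σ (t + 1) = Equiv.swap (j t) (j (t + 1)) * σ t := fun t => rfl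
  have hσlast : ∀ t, σ t (Fin.last k) = j t := by
    intro t
    induction t with
    | zero => exact Equiv.swap_apply_left _ _
    | succ t ih => rw [hσ, Equiv.Perm.mul_apply, ih, Equiv.swap_apply_left]
  let π : V → V := fun v => if v ∈ X then v else a
  have hπX : ∀ v ∈ X, π v = v := fun v hv => if_pos hv
  have hπ : ∀ v ∉ X, π v = a := fun v hv => if_neg hv
  have hπadj : ∀ v w, G.Adj v w → π w = π v ∨ G.Adj (π v) (π w) := by
    intro v w h
    by_cases hv : v ∈ X <;> by_cases hw : w ∈ X
    · rw [hπX v hv, hπX w hw]; exact Or.inr h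
    · rw [hπX v hv, hπ w hw]; exact Or.inl (ha v hv w hw h).symm
    · rw [hπ v hv, hπX w hw]; exact Or.inl (ha w hw v hv h.symm)
    · rw [hπ v hv, hπ w hw]; exact Or.inl rfl
  -- Relabelling is invisible after projecting to `X`: at time `t + 1` the lion `j (t + 1)` is
  -- outside `X`, and `j t` is outside or has just entered at `a`, so both project to `a`.
  have key : ∀ t (i : Fin k), π (p.pos (t + 1) (σ (t + 1) i.castSucc)) =
      π (p.pos (t + 1) (σ t i.castSucc)) := by
    intro t i
    have hne : σ t i.castSucc ≠ j t := by
      rw [← hσlast t]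
      exact fun h => (Fin.castSucc_lt_last i).ne ((σ t).injective h)
    rw [hσ, Equiv.Perm.mul_apply]
    by_cases h : σ t i.castSucc = j (t + 1)
    · rw [h, Equiv.swap_apply_right, hπ _ (hj (t + 1))]
      by_cases hX : p.pos (t + 1) (j t) ∈ X
      · rw [hπX _ hX]
        rcases p.step t (j t) with h' | h'
        · exact absurd (h' ▸ hX) (hj t)
        · exact ha _ hX _ (hj t) h'.symm
      · exact hπ _ hX
    · rw [Equiv.swap_apply_of_ne_of_ne hne h]
  have hidx : ∀ s w, w ∈ X → ∀ l, p.pos s l = w → ∃ i : Fin k, σ s i.castSucc = l := by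
    intro s w hw l hl
    have : (σ s).symm l ≠ Fin.last k := by
      intro h
      rw [Equiv.symm_apply_eq, hσlast] at h
      exact hj s (h ▸ hl ▸ hw)
    obtain ⟨i, hi⟩ := Fin.exists_castSucc_eq.2 this
    exact ⟨i, by rw [hi, Equiv.apply_symm_apply]⟩
  refine ⟨⟨fun t i => g (π (p.pos t (σ t i.castSucc))), fun t i => ?_⟩, ?_, ?_⟩
  · rw [key]
    rcases p.step t (σ t i.castSucc) with h | h
    · exact Or.inl (by rw [h])
    · rcases hπadj _ _ h with h | h
      · exact Or.inl (by rw [h])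
      · exact hg _ _ h
  · rintro s w ⟨l, hl⟩
    obtain ⟨i, hi⟩ := hidx s _ (hfX w) l hl
    exact ⟨i, by simp only [hi, hl, hπX _ (hfX w), hgf]⟩
  · rintro s v w ⟨l, hl⟩
    obtain ⟨hv, hw⟩ := Prod.ext_iff.1 hl
    simp only at hv hw
    obtain ⟨i, hi⟩ := hidx s _ (hfX v) l hv
    exact ⟨i, by simp only [key, hi, hv, hw, hπX _ (hfX _), hgf]⟩

end LionPath

/-! ### Retracts and the number of lions -/

section Clearable

variable {V W : Type*} {G : SimpleGraph V} {H : SimpleGraph W} {k : ℕ}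

/-- The images under `g` of the lions on `G` guard every vertex and edge of `H` whose image under
`f` was guarded. Since `g` may contract edges, subdivided paths can be collapsed. -/
theorem LionClearable.of_retract (f : W → V) (g : V → W)
    (hf : ∀ a b, H.Adj a b → G.Adj (f a) (f b))
    (hg : ∀ a b, G.Adj a b → g b = g a ∨ H.Adj (g a) (g b)) (hgf : ∀ w, g (f w) = w)
    (h : LionClearable G k) : LionClearable H k := by
  obtain ⟨p, t, ht⟩ := h
  refine ⟨p.map g hg, t, Set.eq_empty_iff_forall_notMem.2 fun w hw => ?_⟩
  have := p.mem_contaminated_of_dominated (p.map g hg) f hf t ?_ ?_ w hw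
  · rw [ht] at this
    exact this
  · rintro s - w ⟨j, hj⟩
    exact ⟨j, by simp only [LionPath.map, hj, hgf]⟩
  · rintro s - v w ⟨j, hj⟩
    obtain ⟨hv, hw⟩ := Prod.ext_iff.1 hj
    simp only at hv hw
    exact ⟨j, by simp only [LionPath.map, hv, hw, hgf]⟩

theorem LionClearable.succ [Nonempty V] (h : LionClearable G k) : LionClearable G (k + 1) := by
  obtain ⟨p, t, ht⟩ := h
  let q : LionPath G (k + 1) :=
    ⟨fun t => Fin.snoc (p.pos t) (Classical.arbitrary V), fun t j => by
      induction j using Fin.lastCases with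
      | last => simp
      | cast j => simpa using p.step t j⟩
  refine ⟨q, t, Set.eq_empty_iff_forall_notMem.2 fun w hw => ?_⟩
  have := p.mem_contaminated_of_dominated q id (fun _ _ h => h) t ?_ ?_ w hw
  · rw [ht] at this
    exact this
  · rintro s - w ⟨j, hj⟩
    exact ⟨j.castSucc, by simpa [q] using hj⟩
  · rintro s - v w ⟨j, hj⟩
    exact ⟨j.castSucc, by simpa [q] using hj⟩

theorem LionClearable.mono [Nonempty V] {l : ℕ} (hkl : k ≤ l) (h : LionClearable G k) :
    LionClearable G l := by
  induction l, hkl using Nat.le_induction with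
  | base => exact h
  | succ l _ ih => exact ih.succ

theorem not_lionClearable_zero [Nonempty V] : ¬ LionClearable G 0 := by
  rintro ⟨p, t, ht⟩
  have : ∀ t, p.contaminated t = Set.univ := by
    intro t
    induction t with
    | zero => simp [LionPath.contaminated, LionPath.occupied]
    | succ t ih => simp [LionPath.contaminated, LionPath.occupied, ih]
  exact Set.empty_ne_univ (ht ▸ this t)

end Clearable

/-! ### Branches attached by a single edge -/

/-- `X` is a set of vertices that is joined to its complement only by the edge between `a ∈ X`
and `x ∉ X`. -/
structure IsBranch {V : Type*} (G : SimpleGraph V) (x : V) (X : Set V) (a : V) : Prop where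
  notMem : x ∉ X
  gate_mem : a ∈ X
  adj : G.Adj x a
  eq_of_adj : ∀ v ∈ X, ∀ w ∉ X, G.Adj v w → v = a ∧ w = x

namespace IsBranch

variable {V W : Type*} {G : SimpleGraph V} {H : SimpleGraph W} {k : ℕ} {x a : V} {X : Set V}

theorem dist_gate (h : IsBranch G x X a) : G.dist x a = 1 :=
  SimpleGraph.dist_eq_one_iff_adj.2 h.adj

theorem one_le_dist (h : IsBranch G x X a) (hG : G.Connected) {v : V} (hv : v ∈ X) :
    1 ≤ G.dist x v :=
  hG.pos_dist_of_ne fun e => h.notMem (e ▸ hv)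

theorem eq_gate_of_dist_le_one (h : IsBranch G x X a) (hG : G.Connected) {v : V} (hv : v ∈ X)
    (hd : G.dist x v ≤ 1) : v = a := by
  have := SimpleGraph.dist_eq_one_iff_adj.1 (le_antisymm hd (h.one_le_dist hG hv))
  exact (h.eq_of_adj v hv x h.notMem this.symm).1

theorem _root_.SimpleGraph.Connected.dist_le_of_adj (hG : G.Connected) {v w : V} (x : V)
    (h : G.Adj v w) : G.dist x w ≤ G.dist x v + 1 := by
  have := hG.dist_triangle (u := x) (v := v) (w := w)
  rwa [SimpleGraph.dist_eq_one_iff_adj.2 h] at this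

theorem _root_.SimpleGraph.Connected.exists_adj_dist (hG : G.Connected) {x v : V} (h : x ≠ v) :
    ∃ w, G.Adj v w ∧ G.dist x w + 1 = G.dist x v := by
  obtain ⟨p, hp⟩ := hG.exists_walk_length_eq_dist v x
  cases p with
  | nil => exact absurd rfl h
  | @cons _ w _ hw q =>
    refine ⟨w, hw, le_antisymm ?_ (hG.dist_le_of_adj x hw.symm)⟩
    rw [SimpleGraph.dist_comm (u := x) (v := v), ← hp, SimpleGraph.Walk.length_cons]
    have := SimpleGraph.dist_le q
    rw [SimpleGraph.dist_comm] at this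
    omega

theorem exists_parent (h : IsBranch G x X a) (hG : G.Connected) {v : V} (hv : v ∈ X)
    (hd : 2 ≤ G.dist x v) : ∃ w ∈ X, G.Adj v w ∧ G.dist x w + 1 = G.dist x v := by
  obtain ⟨w, hw, hd'⟩ := hG.exists_adj_dist (x := x) (v := v) fun e => h.notMem (e ▸ hv)
  refine ⟨w, by_contra fun hwX => ?_, hw, hd'⟩
  rw [(h.eq_of_adj v hv w hwX hw).2, SimpleGraph.dist_self] at hd'
  omega

theorem exists_dist_eq (h : IsBranch G x X a) (hG : G.Connected) {n : ℕ} (hn : 1 ≤ n) {v : V}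
    (hv : v ∈ X) (hd : n ≤ G.dist x v) : ∃ w ∈ X, G.dist x w = n := by
  obtain ⟨d, hd'⟩ := Nat.exists_eq_add_of_le hd
  clear hd
  induction d generalizing v with
  | zero => exact ⟨v, hv, by omega⟩
  | succ d ih =>
    obtain ⟨w, hw, -, hdw⟩ := h.exists_parent hG hv (by omega)
    exact ih hw (by omega)

/-- If all lions have left a contaminated branch, then its gate is contaminated. -/
theorem gate_mem_contaminated (h : IsBranch G x X a) (hG : G.Connected) (p : LionPath G k)
    {t : ℕ} (ht : ∀ j, p.pos t j ∉ X) {v : V} (hv : v ∈ X) (hvt : v ∈ p.contaminated t) :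
    a ∈ p.contaminated t := by
  -- With `n` steps left, a lion in `X` must still be able to get out in time, so its depth is at
  -- most `n`.
  have hlion : ∀ n s, s + n = t → ∀ j, p.pos s j ∈ X → G.dist x (p.pos s j) ≤ n := by
    intro n
    induction n with
    | zero =>
      rintro s rfl j hj
      exact absurd hj (ht j)
    | succ n ih =>
      intro s hs j hj
      by_cases hj' : p.pos (s + 1) j ∈ X
      · have h₁ := ih (s + 1) (by omega) j hj'
        rcases p.step s j with e | e
        · rw [← e]; omega
        · have := hG.dist_le_of_adj x e.symm
          omega
      · rcases p.step s j with e | e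
        · exact absurd (e ▸ hj) hj'
        · rw [(h.eq_of_adj _ hj _ hj' e).1, h.dist_gate]
          omega
  have hfree : ∀ s n, s + n = t → ∀ v ∈ X, n + 1 ≤ G.dist x v → v ∉ p.occupied s := by
    rintro s n hs v hv hd ⟨j, rfl⟩
    have := hlion n s hs j hv
    omega
  -- The contamination follows the retreating lions: if something at depth at least `n + 1` is
  -- contaminated, then so is something just behind the last possible lion. At `n = 0` this is the
  -- gate.
  have main : ∀ s n, s + n = t → (∃ v ∈ X, v ∈ p.contaminated s ∧ n + 1 ≤ G.dist x v) →
      ∃ v ∈ X, v ∈ p.contaminated s ∧ G.dist x v = n + 1 := by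
    intro s
    induction s with
    | zero =>
      rintro n hn ⟨v, hv, -, hd⟩
      obtain ⟨w, hw, hdw⟩ := h.exists_dist_eq hG (by omega) hv hd
      exact ⟨w, hw, hfree 0 n hn w hw hdw.ge, hdw⟩
    | succ s ih =>
      rintro n hn ⟨v, hv, hvs, hd⟩
      rcases hd.eq_or_lt with hd | hd
      · exact ⟨v, hv, hvs, hd.symm⟩
      have hprev : ∃ u ∈ X, u ∈ p.contaminated s ∧ n + 1 ≤ G.dist x u := by
        rcases p.exists_of_mem_contaminated_succ hvs with h' | ⟨u, hu, hvu, -, -⟩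
        · exact ⟨v, hv, h', by omega⟩
        · refine ⟨u, by_contra fun huX => ?_, hu, ?_⟩
          · have := h.dist_gate
            rw [← (h.eq_of_adj v hv u huX hvu).1] at this
            omega
          · have := hG.dist_le_of_adj x hvu.symm
            omega
      obtain ⟨u, huX, hus, hdu⟩ := hprev
      rcases hdu.eq_or_lt with hdu | hdu
      · exact ⟨u, huX, p.mem_contaminated_stay hus (hfree (s + 1) n hn u huX hdu.le), hdu.symm⟩
      · obtain ⟨y, hyX, hys, hdy⟩ := ih (n + 1) (by omega) ⟨u, huX, hus, hdu⟩
        obtain ⟨z, hzX, hyz, hdz⟩ := h.exists_parent hG hyX (by omega)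
        have hz := hfree (s + 1) n hn z hzX (by omega)
        have hy := hfree (s + 1) n hn y hyX (by omega)
        exact ⟨z, hzX, p.mem_contaminated_spread hys hyz.symm hz
          (fun e => hy (p.right_mem_occupied_of_mem_moves e))
          (fun e => hz (p.right_mem_occupied_of_mem_moves e)), by omega⟩
  obtain ⟨w, hw, hwt, hdw⟩ := main t 0 rfl ⟨v, hv, hvt, h.one_le_dist hG hv⟩
  exact h.eq_gate_of_dist_le_one hG hw hdw.le ▸ hwt

/-- If `H` is a retract of `G` inside of the branch `X` that `k` lions cannot clear, and one of the
`k + 1` lions has always been outside `X`, then `X` is contaminated. -/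
theorem exists_contaminated_of_start (h : IsBranch G x X a) (hH : ¬ LionClearable H k)
    (f : W → V) (g : V → W) (hf : ∀ a b, H.Adj a b → G.Adj (f a) (f b)) (hfX : ∀ w, f w ∈ X)
    (hg : ∀ a b, G.Adj a b → g b = g a ∨ H.Adj (g a) (g b)) (hgf : ∀ w, g (f w) = w)
    (p : LionPath G (k + 1)) {t : ℕ} (hp : ∀ s ≤ t, ∃ j, p.pos s j ∉ X) :
    ∃ v ∈ X, v ∈ p.contaminated t := by
  -- The slice stands still after time `t`, so some lion is outside `X` at all times, as the lemma
  -- requires.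
  obtain ⟨q, hqo, hqm⟩ := (p.slice 0 t).exists_dominating_of_exists_notMem (H := H)
    (fun v hv w hw e => (h.eq_of_adj v hv w hw e).1)
    (fun s => hp _ (by omega)) f g hfX hg hgf
  obtain ⟨w, hw⟩ := Set.nonempty_iff_ne_empty.2 fun e => hH ⟨q, t, e⟩
  refine ⟨f w, hfX w, p.mem_contaminated_of_dominated q f hf t ?_ ?_ w hw⟩
  · intro s hs w hw
    refine hqo s w ?_
    rwa [p.slice_occupied hs, zero_add]
  · intro s hs v w hw
    refine hqm s v w ?_
    rwa [p.slice_moves hs, zero_add]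

/-- The same if at some time there was no lion in `X`, the gate was contaminated, and since then
one of the lions has always been outside `X`. -/
theorem exists_contaminated_of_gate (h : IsBranch G x X a) (hG : G.Connected)
    (hH : ¬ LionClearable H k)
    (f : W → V) (g : V → W) (hf : ∀ a b, H.Adj a b → G.Adj (f a) (f b)) (hfX : ∀ w, f w ∈ X)
    (hg : ∀ a b, G.Adj a b → g b = g a ∨ H.Adj (g a) (g b)) (hgf : ∀ w, g (f w) = w)
    (p : LionPath G (k + 1)) {r n : ℕ} (hr : ∀ j, p.pos r j ∉ X) (ha : a ∈ p.contaminated r)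
    (hp : ∀ s ≤ n, ∃ j, p.pos (r + s) j ∉ X) :
    ∃ v ∈ X, v ∈ p.contaminated (r + n) := by
  obtain ⟨q, hqo, hqm⟩ := (p.slice r n).exists_dominating_of_exists_notMem (H := H)
    (fun v hv w hw e => (h.eq_of_adj v hv w hw e).1)
    (fun s => hp _ (by omega)) f g hfX hg hgf
  have hlion : ∀ s j, p.pos (r + s) j ∈ X → G.dist x (p.pos (r + s) j) ≤ s := by
    intro s j
    induction s with
    | zero => exact fun hj => absurd hj (hr j)
    | succ s ih =>
      rw [← add_assoc]
      intro hj
      by_cases hj' : p.pos (r + s) j ∈ X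
      · rcases p.step (r + s) j with e | e
        · rw [e]
          have := ih hj'
          omega
        · have h₁ := hG.dist_le_of_adj x e
          have h₂ := ih hj'
          omega
      · rcases p.step (r + s) j with e | e
        · exact absurd (e ▸ hj) hj'
        · rw [(h.eq_of_adj _ hj _ hj' e.symm).1, h.dist_gate]
          omega
  have hfree : ∀ s, ∀ v ∈ X, s + 1 ≤ G.dist x v → v ∉ p.occupied (r + s) := by
    rintro s v hv hd ⟨j, rfl⟩
    have := hlion s j hv
    omega
  -- After `s` steps the lions have depth at most `s`, so the front at depth `s + 1` advances
  -- unhindered.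
  have hfront : ∀ s, ∀ v ∈ X, G.dist x v = s + 1 → v ∈ p.contaminated (r + s) := by
    intro s
    induction s with
    | zero =>
      intro v hv hd
      rw [h.eq_gate_of_dist_le_one hG hv (by omega)]
      exact ha
    | succ s ih =>
      intro v hv hd
      obtain ⟨u, hu, hvu, hdu⟩ := h.exists_parent hG hv (by omega)
      refine p.mem_contaminated_spread (ih u hu (by omega)) hvu (hfree (s + 1) v hv (by omega))
        (fun e => ?_) (fun e => ?_)
      · exact hfree s v hv (by omega) (p.left_mem_occupied_of_mem_moves e)
      · exact hfree (s + 1) v hv (by omega) (p.right_mem_occupied_of_mem_moves e)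
  -- Up to the front, `p` is at least as contaminated as `q`, which starts with everything
  -- unoccupied contaminated. Whatever `q` gets from beyond the front, `p` has from the front
  -- itself.
  have main : ∀ s ≤ n, ∀ w ∈ q.contaminated s, G.dist x (f w) ≤ s + 1 →
      f w ∈ p.contaminated (r + s) := by
    intro s
    induction s with
    | zero =>
      intro _ w _ hd
      exact hfront 0 (f w) (hfX w) (le_antisymm hd (h.one_le_dist hG (hfX w)))
    | succ s ih =>
      intro hs w hw hd
      rcases hd.eq_or_lt with hd | hd
      · exact hfront (s + 1) (f w) (hfX w) hd
      have hwo : f w ∉ p.occupied (r + s + 1) := fun e =>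
        q.notMem_occupied_of_mem_contaminated hw
          (hqo _ w (by rwa [p.slice_occupied hs]))
      rcases q.exists_of_mem_contaminated_succ hw with h' | ⟨u, hu, hwu, h₁, h₂⟩
      · exact p.mem_contaminated_stay (ih (by omega) w h' (by omega)) hwo
      · by_cases hdu : G.dist x (f u) ≤ s + 1
        · exact p.mem_contaminated_spread (ih (by omega) u hu hdu) (hf _ _ hwu) hwo
            (fun e => h₁ (hqm s _ _ (by rwa [p.slice_moves hs])))
            (fun e => h₂ (hqm s _ _ (by rwa [p.slice_moves hs])))
        · have := hG.dist_le_of_adj x (hf _ _ hwu)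
          exact p.mem_contaminated_stay (hfront s (f w) (hfX w) (by omega)) hwo
  obtain ⟨w, hw⟩ := Set.nonempty_iff_ne_empty.2 fun e => hH ⟨q, n, e⟩
  by_cases hd : G.dist x (f w) ≤ n + 1
  · exact ⟨f w, hfX w, main n le_rfl w hw hd⟩
  · obtain ⟨v, hv, hdv⟩ := h.exists_dist_eq hG (n := n + 1) (by omega) (hfX w) (by omega)
    exact ⟨v, hv, hfront n v hv hdv⟩

end IsBranch

/-! ### Three branches force an additional lion -/

/-- Three branches of a graph at the vertex `x`, which contain all other vertices. -/
structure ThreeBranches {V : Type*} (G : SimpleGraph V) where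
  x : V
  branch : V → Option (Fin 3)
  gate : Fin 3 → V
  branch_eq_none : ∀ v, branch v = none ↔ v = x
  branch_gate : ∀ j, branch (gate j) = some j
  adj_gate : ∀ j, G.Adj x (gate j)
  branch_of_adj : ∀ v w, G.Adj v w →
    branch w = branch v ∨ (v = x ∧ ∃ j, w = gate j) ∨ (w = x ∧ ∃ j, v = gate j)

namespace ThreeBranches

variable {V W : Type*} {G : SimpleGraph V} {H : SimpleGraph W} {k : ℕ}

theorem isBranch (B : ThreeBranches G) (j : Fin 3) :
    IsBranch G B.x {v | B.branch v = some j} (B.gate j) where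
  notMem h := by simp [(B.branch_eq_none B.x).2 rfl] at h
  gate_mem := B.branch_gate j
  adj := B.adj_gate j
  eq_of_adj v hv w hw h := by
    simp only [Set.mem_ofPred_eq] at hv hw
    rcases B.branch_of_adj v w h with e | ⟨rfl, -⟩ | ⟨rfl, i, rfl⟩
    · exact absurd (e.trans hv) hw
    · simp [(B.branch_eq_none B.x).2 rfl] at hv
    · rw [B.branch_gate, Option.some_inj] at hv
      exact ⟨by rw [hv], rfl⟩

/-- One of the lions of `p` has always been outside the branch `j` since a time at which the branch
was completely contaminated or was entered by the contamination. -/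
def Robust (B : ThreeBranches G) (p : LionPath G k) (t : ℕ) (j : Fin 3) : Prop :=
  ∃ r ≤ t, (r = 0 ∨ ((∀ i, B.branch (p.pos r i) ≠ some j) ∧ B.gate j ∈ p.contaminated r)) ∧
    ∀ s, r ≤ s → s ≤ t → ∃ i, B.branch (p.pos s i) ≠ some j

/-- The contamination is about to enter the branch `j`. -/
def Exposed (B : ThreeBranches G) (p : LionPath G k) (t : ℕ) (j : Fin 3) : Prop :=
  B.x ∈ p.contaminated t ∧ ∀ i, B.branch (p.pos t i) ≠ some j

theorem Robust.exists_contaminated {B : ThreeBranches G} (hG : G.Connected)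
    (hH : ¬ LionClearable H k) (f : Fin 3 → W → V) (g : V → W)
    (hf : ∀ j a b, H.Adj a b → G.Adj (f j a) (f j b)) (hfB : ∀ j w, B.branch (f j w) = some j)
    (hg : ∀ a b, G.Adj a b → g b = g a ∨ H.Adj (g a) (g b)) (hgf : ∀ j w, g (f j w) = w)
    {p : LionPath G (k + 1)} {t : ℕ} {j : Fin 3} (h : B.Robust p t j) :
    ∃ v, B.branch v = some j ∧ v ∈ p.contaminated t := by
  obtain ⟨r, hrt, hr, hs⟩ := h
  rcases hr with rfl | ⟨hr, ha⟩
  · exact (B.isBranch j).exists_contaminated_of_start hH (f j) g (hf j) (hfB j) hg (hgf j) p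
      fun s hst => hs s (Nat.zero_le s) hst
  · obtain ⟨n, rfl⟩ := Nat.exists_eq_add_of_le hrt
    exact (B.isBranch j).exists_contaminated_of_gate hG hH (f j) g (hf j) (hfB j) hg (hgf j) p
      hr ha fun s hsn => hs (r + s) (by omega) (by omega)

theorem Robust.succ {B : ThreeBranches G} {p : LionPath G k} {t : ℕ} {j : Fin 3}
    (h : B.Robust p t j) (ht : ∃ i, B.branch (p.pos (t + 1) i) ≠ some j) :
    B.Robust p (t + 1) j := by
  obtain ⟨r, hrt, hr, hs⟩ := h
  refine ⟨r, by omega, hr, fun s hrs hst => ?_⟩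
  rcases hst.eq_or_lt with rfl | hst
  · exact ht
  · exact hs s hrs (by omega)

theorem branch_succ (B : ThreeBranches G) (p : LionPath G k) {t : ℕ} {i : Fin k} {j : Fin 3}
    (h : B.branch (p.pos (t + 1) i) = some j) :
    B.branch (p.pos t i) = some j ∨ p.pos t i = B.x := by
  rcases p.step t i with e | e
  · exact Or.inl (e ▸ h)
  · rcases B.branch_of_adj _ _ e with e' | ⟨e', -⟩ | ⟨e', -⟩
    · exact Or.inl (e' ▸ h)
    · exact Or.inr e'
    · rw [e', (B.branch_eq_none B.x).2 rfl] at h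
      cases h

/-- A contaminated `x` carries no lion, so no lion can enter the branch in the step in which the
contamination does. -/
theorem Exposed.succ {B : ThreeBranches G} {p : LionPath G (k + 1)} {t : ℕ} {j : Fin 3}
    (h : B.Exposed p t j) : B.Robust p (t + 1) j := by
  have hx := p.notMem_occupied_of_mem_contaminated h.1
  have hfree : ∀ i, B.branch (p.pos (t + 1) i) ≠ some j := fun i hi =>
    (B.branch_succ p hi).elim (h.2 i) fun e => hx ⟨i, e⟩
  have ha : B.gate j ∉ p.occupied (t + 1) := by
    rintro ⟨i, hi⟩
    exact hfree i (hi ▸ B.branch_gate j)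
  refine ⟨t + 1, le_rfl, Or.inr ⟨hfree, ?_⟩, fun s h₁ h₂ => ⟨0, ?_⟩⟩
  · refine p.mem_contaminated_spread h.1 (B.adj_gate j).symm ha (fun e => ?_) (fun e => ?_)
    · obtain ⟨i, hi⟩ := p.left_mem_occupied_of_mem_moves e
      exact h.2 i (hi ▸ B.branch_gate j)
    · exact ha (p.right_mem_occupied_of_mem_moves e)
  · rw [le_antisymm h₂ h₁]
    exact hfree 0

/-- If each of three branches at a vertex of a graph retracts onto a graph that `k` lions cannot
clear, then `k + 1` lions cannot clear the graph. -/
theorem not_lionClearable_succ (B : ThreeBranches G) (hG : G.Connected)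
    (hH : ¬ LionClearable H k) (f : Fin 3 → W → V) (g : V → W)
    (hf : ∀ j a b, H.Adj a b → G.Adj (f j a) (f j b)) (hfB : ∀ j w, B.branch (f j w) = some j)
    (hg : ∀ a b, G.Adj a b → g b = g a ∨ H.Adj (g a) (g b)) (hgf : ∀ j w, g (f j w) = w) :
    ¬ LionClearable G (k + 1) := by
  rintro ⟨p, T, hT⟩
  have hcont : ∀ {t j}, B.Robust p t j → ∃ v, B.branch v = some j ∧ v ∈ p.contaminated t :=
    fun h => h.exists_contaminated hG hH f g hf hfB hg hgf
  -- At most one branch `l` is out of control. It changes only when all lions are in another branch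
  -- `j`; then `l` becomes exposed and `j` becomes the exceptional branch.
  have inv : ∀ t, ∃ l, ∀ j ≠ l, B.Robust p t j ∨ B.Exposed p t j := by
    intro t
    induction t with
    | zero =>
      by_cases h : ∃ l, ∀ i, B.branch (p.pos 0 i) = some l
      · obtain ⟨l, hl⟩ := h
        refine ⟨l, fun j hj => Or.inl ⟨0, le_rfl, Or.inl rfl, fun s _ hs => ⟨0, ?_⟩⟩⟩
        rw [Nat.le_zero.1 hs, hl]
        exact fun e => hj (Option.some_inj.1 e).symm
      · push Not at h
        exact ⟨0, fun j _ => Or.inl ⟨0, le_rfl, Or.inl rfl, fun s _ hs => Nat.le_zero.1 hs ▸ h j⟩⟩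
    | succ t ih =>
      obtain ⟨l, hl⟩ := ih
      by_cases h : ∃ j ≠ l, ∀ i, B.branch (p.pos (t + 1) i) = some j
      · obtain ⟨j, hjl, hj⟩ := h
        have hother : ∀ j' ≠ j, ∀ i, B.branch (p.pos (t + 1) i) ≠ some j' := fun j' hj' i e =>
          hj' (Option.some_inj.1 (e.symm.trans (hj i)))
        have hx' : B.x ∉ p.occupied (t + 1) := by
          rintro ⟨i, hi⟩
          have := hj i
          rw [hi, (B.branch_eq_none B.x).2 rfl] at this
          cases this
        refine ⟨j, fun j' hj' => ?_⟩
        by_cases hjl' : j' = l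
        · subst hjl'
          refine Or.inr ⟨?_, hother _ hj'⟩
          -- The third branch recontaminates `x`: the lions, all in `j` one step later, are not in
          -- `z` at time `t`, so a contaminated `z` has a contaminated gate.
          obtain ⟨z, hzl, hzj⟩ : ∃ z : Fin 3, z ≠ j' ∧ z ≠ j := by
            clear * -
            decide +revert
          rcases hl z hzl with hz | hz
          · obtain ⟨v, hv, hvt⟩ := hcont hz
            have hzfree : ∀ i, p.pos t i ∉ {v | B.branch v = some z} := by
              intro i (hi : B.branch _ = _)
              have := B.branch_succ p (hj i)
              rw [hi, Option.some_inj] at this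
              rcases this with e | e
              · exact hzj e
              · rw [e, (B.branch_eq_none B.x).2 rfl] at hi
                cases hi
            have ha := (B.isBranch z).gate_mem_contaminated hG p hzfree hv hvt
            refine p.mem_contaminated_spread ha (B.adj_gate z) hx' (fun e => ?_) (fun e => ?_)
            · obtain ⟨i, hi⟩ := p.right_mem_occupied_of_mem_moves e
              exact hother z hzj i (hi ▸ B.branch_gate z)
            · exact hx' (p.right_mem_occupied_of_mem_moves e)
          · exact p.mem_contaminated_stay hz.1 hx'
        · exact Or.inl ((hl j' hjl').elim (fun h => h.succ ⟨0, hother j' hj' 0⟩) fun h => h.succ)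
      · push Not at h
        exact ⟨l, fun j hj => Or.inl ((hl j hj).elim (fun h' => h'.succ (h j hj)) fun h' => h'.succ)⟩
  obtain ⟨l, hl⟩ := inv T
  rcases hl (l + 1) (by clear * -; decide +revert) with h | h
  · obtain ⟨v, -, hv⟩ := hcont h
    rw [hT] at hv
    exact hv
  · have := h.1
    rw [hT] at this
    exact this

end ThreeBranches

/-! ### Two lions cannot clear a claw with a universal vertex -/

section Claw

set_option synthInstance.maxHeartbeats 200000 in
set_option synthInstance.maxSize 1000 in
/-- Two lions cannot clear the graph with two vertices that are adjacent to each other and to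
three further vertices. -/
theorem not_lionClearable_two_addUniversal_addUniversal_bot :
    ¬ LionClearable (addUniversal (addUniversal (⊥ : SimpleGraph (Fin 3)))) 2 := by
  rintro ⟨p, T, hT⟩
  let hub : Bool → Option (Option (Fin 3)) := fun b => if b then none else some none
  let leaf : Fin 3 → Option (Option (Fin 3)) := fun a => some (some a)
  have hadj : ∀ b v, v ≠ hub b → (addUniversal (addUniversal (⊥ : SimpleGraph (Fin 3)))).Adj v
      (hub b) := by
    rintro (_ | _) (_ | _ | v) hv <;> trivial
  -- Removing two vertices leaves the hub, or removes at most one of the three leaves.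
  have hcount : ∀ (b : Bool) (e₁ e₂ : Option (Option (Fin 3))), (hub b ≠ e₁ ∧ hub b ≠ e₂) ∨
      ∃ a c, a ≠ c ∧ leaf a ≠ e₁ ∧ leaf a ≠ e₂ ∧ leaf c ≠ e₁ ∧ leaf c ≠ e₂ := by
    decide
  have hhub : ∀ b, hub b ≠ hub !b := by decide
  have hleaf : ∀ b a, leaf a ≠ hub b := by decide
  have hleaf' : Function.Injective leaf := fun a c h => by simpa [leaf] using h
  have inv : ∀ t, (∃ b, hub b ∈ p.contaminated t) ∨
      ∃ a c, a ≠ c ∧ leaf a ∈ p.contaminated t ∧ leaf c ∈ p.contaminated t := by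
    intro t
    induction t with
    | zero =>
      have h : ∀ v, v ≠ p.pos 0 0 → v ≠ p.pos 0 1 → v ∈ p.contaminated 0 := by
        rintro v h₀ h₁ ⟨i, rfl⟩
        revert h₀ h₁
        fin_cases i <;> simp
      rcases hcount true (p.pos 0 0) (p.pos 0 1) with ⟨h₀, h₁⟩ | ⟨a, c, hac, h₁, h₂, h₃, h₄⟩
      · exact Or.inl ⟨true, h _ h₀ h₁⟩
      · exact Or.inr ⟨a, c, hac, h _ h₁ h₂, h _ h₃ h₄⟩
    | succ t ih =>
      rcases ih with ⟨b, hb⟩ | ⟨a, c, hac, ha, hc⟩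
      · by_cases hocc : hub b ∈ p.occupied (t + 1)
        · obtain ⟨i, hi⟩ := hocc
          obtain ⟨i', hii⟩ : ∃ i' : Fin 2, ∀ l, l = i ∨ l = i' := by
            clear * -
            decide +revert
          have hbt := p.notMem_occupied_of_mem_contaminated hb
          -- A contaminated hub infects all its neighbours except where lion `i` came from and one
          -- vertex due to the other lion: its old position if it also moved to the hub, otherwise
          -- its new one.
          obtain ⟨e, he⟩ : ∃ e, ∀ v, v ≠ hub b → v ≠ p.pos t i → v ≠ e →
              v ∈ p.contaminated (t + 1) := by
            by_cases hi' : p.pos (t + 1) i' = hub b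
            · refine ⟨p.pos t i', fun v h₀ h₁ h₂ =>
                p.mem_contaminated_spread hb (hadj b v h₀) ?_ ?_ ?_⟩
              · rintro ⟨l, rfl⟩
                rcases hii l with rfl | rfl
                · exact h₀ hi
                · exact h₀ hi'
              · rintro ⟨l, hl⟩
                have := (Prod.ext_iff.1 hl).1
                rcases hii l with rfl | rfl
                · exact h₁ this.symm
                · exact h₂ this.symm
              · exact fun h => hbt (p.left_mem_occupied_of_mem_moves h)
            · refine ⟨p.pos (t + 1) i', fun v h₀ h₁ h₂ =>
                p.mem_contaminated_spread hb (hadj b v h₀) ?_ ?_ ?_⟩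
              · rintro ⟨l, rfl⟩
                rcases hii l with rfl | rfl
                · exact h₀ hi
                · exact h₂ rfl
              · rintro ⟨l, hl⟩
                obtain ⟨hl₁, hl₂⟩ := Prod.ext_iff.1 hl
                rcases hii l with rfl | rfl
                · exact h₁ hl₁.symm
                · exact hi' hl₂
              · exact fun h => hbt (p.left_mem_occupied_of_mem_moves h)
          rcases hcount (!b) (p.pos t i) e with ⟨h₀, h₁⟩ | ⟨a, c, hac, h₁, h₂, h₃, h₄⟩
          · exact Or.inl ⟨!b, he _ (hhub b).symm h₀ h₁⟩
          · exact Or.inr ⟨a, c, hac, he _ (hleaf b a) h₁ h₂, he _ (hleaf b c) h₃ h₄⟩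
        · exact Or.inl ⟨b, p.mem_contaminated_stay hb hocc⟩
      · by_cases hocc : ∀ b, hub b ∈ p.occupied (t + 1)
        · have hfree : ∀ a, leaf a ∉ p.occupied (t + 1) := by
            rintro a ⟨l, hl⟩
            obtain ⟨i, hi⟩ := hocc true
            obtain ⟨i', hi'⟩ := hocc false
            have h₁ : l ≠ i := by
              rintro rfl
              exact hleaf _ _ (hl.symm.trans hi)
            have h₂ : l ≠ i' := by
              rintro rfl
              exact hleaf _ _ (hl.symm.trans hi')
            have h₃ : i ≠ i' := by
              rintro rfl
              exact hhub true (hi.symm.trans hi')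
            omega
          exact Or.inr ⟨a, c, hac, p.mem_contaminated_stay ha (hfree a),
            p.mem_contaminated_stay hc (hfree c)⟩
        · push Not at hocc
          obtain ⟨b, hb⟩ := hocc
          have hat := p.notMem_occupied_of_mem_contaminated ha
          have hct := p.notMem_occupied_of_mem_contaminated hc
          -- The free hub stays clean only if both lions left it along the edges to `a` and `c`;
          -- then the other hub is unguarded.
          by_cases h₁ : (hub b, leaf a) ∈ p.moves t
          · by_cases h₂ : (hub b, leaf c) ∈ p.moves t
            · obtain ⟨i, hi⟩ := h₁
              obtain ⟨i', hi'⟩ := h₂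
              obtain ⟨hi₁, hi₂⟩ := Prod.ext_iff.1 hi
              obtain ⟨hi₁', hi₂'⟩ := Prod.ext_iff.1 hi'
              simp only at hi₁ hi₂ hi₁' hi₂'
              have hii : i ≠ i' := by
                rintro rfl
                exact hac (hleaf' (hi₂.symm.trans hi₂'))
              have hl : ∀ l, l = i ∨ l = i' := by omega
              have hfree : hub (!b) ∉ p.occupied (t + 1) := by
                rintro ⟨l, hl'⟩
                rcases hl l with rfl | rfl
                · exact hleaf _ _ (hi₂.symm.trans hl')
                · exact hleaf _ _ (hi₂'.symm.trans hl')
              refine Or.inl ⟨!b, p.mem_contaminated_spread ha (hadj _ _ (hleaf _ _)).symm hfree ?_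
                fun h => hat (p.left_mem_occupied_of_mem_moves h)⟩
              rintro ⟨l, hl'⟩
              have := (Prod.ext_iff.1 hl').1
              rcases hl l with rfl | rfl
              · exact hhub b (hi₁.symm.trans this)
              · exact hhub b (hi₁'.symm.trans this)
            · exact Or.inl ⟨b, p.mem_contaminated_spread hc (hadj _ _ (hleaf _ _)).symm hb h₂
                fun h => hct (p.left_mem_occupied_of_mem_moves h)⟩
          · exact Or.inl ⟨b, p.mem_contaminated_spread ha (hadj _ _ (hleaf _ _)).symm hb h₁
              fun h => hat (p.left_mem_occupied_of_mem_moves h)⟩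
  have := inv T
  simp [hT] at this

variable {V W : Type*} {G : SimpleGraph V} {H : SimpleGraph W} {k : ℕ}

theorem LionClearable.addUniversal_of_retract (f : W → V) (g : V → W)
    (hf : ∀ a b, H.Adj a b → G.Adj (f a) (f b))
    (hg : ∀ a b, G.Adj a b → g b = g a ∨ H.Adj (g a) (g b)) (hgf : ∀ w, g (f w) = w)
    (h : LionClearable (addUniversal G) k) : LionClearable (addUniversal H) k := by
  refine h.of_retract (Option.map f) (Option.map g) ?_ ?_ ?_
  · rintro (_ | a) (_ | b) hab
    · exact hab
    · trivial
    · trivial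
    · exact hf a b hab
  · rintro (_ | a) (_ | b) hab
    · exact Or.inl rfl
    · exact Or.inr trivial
    · exact Or.inr trivial
    · exact (hg a b hab).imp (fun e => by simp [e]) id
  · rintro (_ | w)
    · rfl
    · simp [hgf]

/-- Sending each vertex to its branch retracts `G` onto the claw formed by `x` and the gates. -/
theorem ThreeBranches.not_lionClearable_two_addUniversal (B : ThreeBranches G) :
    ¬ LionClearable (addUniversal G) 2 := by
  refine fun h => not_lionClearable_two_addUniversal_addUniversal_bot
    (h.addUniversal_of_retract (fun o => o.elim B.x B.gate) B.branch ?_ ?_ ?_)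
  · rintro (_ | a) (_ | b) hab
    · exact hab.elim
    · exact B.adj_gate b
    · exact (B.adj_gate a).symm
    · exact hab.elim
  · intro a b hab
    rcases B.branch_of_adj a b hab with e | ⟨rfl, j, rfl⟩ | ⟨rfl, j, rfl⟩
    · exact Or.inl e
    · rw [(B.branch_eq_none B.x).2 rfl, B.branch_gate]
      exact Or.inr trivial
    · rw [(B.branch_eq_none B.x).2 rfl, B.branch_gate]
      exact Or.inr trivial
  · rintro (_ | j)
    · exact (B.branch_eq_none B.x).2 rfl
    · exact B.branch_gate j

end Claw

/-! ### Structure of the joined copies -/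

section Join

variable {V : Type} {G : SimpleGraph V} {r : V} {l : ℕ}

/-- The vertex at distance `j` from the new root on the path to the copy `b`. -/
def pathVertex (r : V) (l : ℕ) (b : Bool) (j : ℕ) : JoinVertex V l :=
  if j = 0 then none else if h : j - 1 < l then some (b, Sum.inr ⟨j - 1, h⟩) else
    some (b, Sum.inl r)

theorem pathVertex_zero (r : V) (l : ℕ) (b : Bool) : pathVertex r l b 0 = none := rfl

theorem pathVertex_succ {b : Bool} {j : ℕ} (h : j < l) :
    pathVertex r l b (j + 1) = some (b, Sum.inr ⟨j, h⟩) := by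
  simp [pathVertex, h]

theorem pathVertex_last (b : Bool) : pathVertex r l b (l + 1) = some (b, Sum.inl r) := by
  simp [pathVertex]

theorem joinTwoCopies_adj_path (b : Bool) {j : ℕ} (hj : j ≤ l) :
    (joinTwoCopies G r l).Adj (pathVertex r l b j) (pathVertex r l b (j + 1)) := by
  rw [joinTwoCopies, SimpleGraph.fromRel_adj]
  rcases hj.lt_or_eq with hj | rfl
  · rw [pathVertex_succ hj]
    cases j with
    | zero => simp [pathVertex_zero, joinRel]
    | succ j => simp [pathVertex_succ (by omega : j < l), joinRel]
  · rw [pathVertex_last]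
    cases j with
    | zero => simp [pathVertex_zero, joinRel]
    | succ j => simp [pathVertex_succ (by omega : j < j + 1), joinRel]

theorem joinTwoCopies_adj_copy (b : Bool) {v w : V} (h : G.Adj v w) :
    (joinTwoCopies G r l).Adj (some (b, Sum.inl v)) (some (b, Sum.inl w)) := by
  rw [joinTwoCopies, SimpleGraph.fromRel_adj]
  simp [joinRel, h, h.ne]

theorem joinRel_cases {v w : JoinVertex V l} (h : joinRel G r l v w) :
    (∃ b, ∃ j ≤ l, v = pathVertex r l b j ∧ w = pathVertex r l b (j + 1)) ∨
      ∃ b v' w', G.Adj v' w' ∧ v = some (b, Sum.inl v') ∧ w = some (b, Sum.inl w') := by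
  rcases v with _ | ⟨b, v | j⟩ <;> rcases w with _ | ⟨b', w | j'⟩
  · exact h.elim
  · obtain ⟨rfl, rfl⟩ := h
    exact Or.inl ⟨b', 0, le_rfl, rfl, (pathVertex_last b').symm⟩
  · refine Or.inl ⟨b', 0, Nat.zero_le _, rfl, ?_⟩
    have h : (j' : ℕ) = 0 := h
    rw [pathVertex_succ (h ▸ j'.2)]
    simp [← h]
  · exact h.elim
  · obtain ⟨rfl, h⟩ := h
    exact Or.inr ⟨b, v, w, h, rfl, rfl⟩
  · exact h.elim
  · exact h.elim
  · obtain ⟨rfl, h, rfl⟩ := h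
    refine Or.inl ⟨b, l, le_rfl, ?_, (pathVertex_last b).symm⟩
    obtain ⟨j, hj⟩ := j
    simp only at h
    subst h
    rw [pathVertex_succ hj]
  · obtain ⟨rfl, h⟩ := h
    refine Or.inl ⟨b, j + 1, j.2, (pathVertex_succ j.2).symm, ?_⟩
    rw [pathVertex_succ (h ▸ j'.2)]
    simp [h]

/-- The edges of `joinTwoCopies G r l` are the edges of the two paths and of the two copies. -/
theorem joinTwoCopies_adj_induction {P : JoinVertex V l → JoinVertex V l → Prop}
    (symm : ∀ v w, P v w → P w v)
    (path : ∀ b, ∀ j ≤ l, P (pathVertex r l b j) (pathVertex r l b (j + 1)))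
    (copy : ∀ b v w, G.Adj v w → P (some (b, Sum.inl v)) (some (b, Sum.inl w)))
    (v w : JoinVertex V l) (h : (joinTwoCopies G r l).Adj v w) : P v w := by
  have key : ∀ v w, joinRel G r l v w → P v w := by
    intro v w h
    rcases joinRel_cases h with ⟨b, j, hj, rfl, rfl⟩ | ⟨b, v, w, h', rfl, rfl⟩
    · exact path b j hj
    · exact copy b v w h'
  rw [joinTwoCopies, SimpleGraph.fromRel_adj] at h
  exact h.2.elim (key v w) fun h => symm _ _ (key w v h)

theorem joinTwoCopies_connected (hG : G.Connected) : (joinTwoCopies G r l).Connected := by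
  have hpath : ∀ b, ∀ j ≤ l + 1, (joinTwoCopies G r l).Reachable none (pathVertex r l b j) := by
    intro b j
    induction j with
    | zero => exact fun _ => SimpleGraph.Reachable.refl _
    | succ j ih =>
      exact fun hj => (ih (by omega)).trans (joinTwoCopies_adj_path b (by omega)).reachable
  have hroot : ∀ v, (joinTwoCopies G r l).Reachable none v := by
    rintro (_ | ⟨b, v | j⟩)
    · exact SimpleGraph.Reachable.refl _
    · have h := hpath b (l + 1) le_rfl
      rw [pathVertex_last] at h
      let F : G →g joinTwoCopies G r l :=
        ⟨fun v => some (b, Sum.inl v), fun h => joinTwoCopies_adj_copy b h⟩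
      exact h.trans ((hG.preconnected r v).map F)
    · have h := hpath b (j + 1) (by omega)
      rwa [pathVertex_succ j.2] at h
  exact (SimpleGraph.connected_iff _).2 ⟨fun v w => (hroot v).symm.trans (hroot w), ⟨none⟩⟩

/-- The map that contracts the paths and identifies the two copies. -/
def joinFold (r : V) (l : ℕ) : JoinVertex V l → V
  | some (_, Sum.inl v) => v
  | _ => r

theorem joinFold_pathVertex (b : Bool) (j : ℕ) : joinFold r l (pathVertex r l b j) = r := by
  rw [pathVertex]
  split_ifs <;> rfl

theorem joinFold_adj : ∀ v w : JoinVertex V l, (joinTwoCopies G r l).Adj v w →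
    joinFold r l w = joinFold r l v ∨ G.Adj (joinFold r l v) (joinFold r l w) := by
  refine joinTwoCopies_adj_induction ?_ ?_ ?_
  · exact fun v w h => h.imp Eq.symm fun h => h.symm
  · exact fun b j _ => Or.inl (by simp only [joinFold_pathVertex])
  · exact fun b v w h => Or.inr h

/-- Every edge is `s(v, parent v)` for some `v ≠ r`, so there are fewer edges than vertices, and a
connected graph with so few edges is a tree. -/
theorem isTree_of_parent [Finite V] (hG : G.Connected) (r : V) (parent : V → V)
    (h : ∀ v w, G.Adj v w → (v ≠ r ∧ parent v = w) ∨ (w ≠ r ∧ parent w = v)) : G.IsTree := by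
  classical
  rw [SimpleGraph.isTree_iff_connected_and_card]
  refine ⟨hG, le_antisymm ?_ hG.card_vert_le_card_edgeSet_add_one⟩
  have hsub : G.edgeSet ⊆ (fun v => s(v, parent v)) '' {v | v ≠ r} := by
    intro e
    induction e with
    | _ v w =>
      intro he
      rcases h v w he with ⟨hv, rfl⟩ | ⟨hw, rfl⟩
      · exact ⟨v, hv, rfl⟩
      · exact ⟨w, hw, Sym2.eq_swap⟩
  have h₁ := Set.ncard_le_ncard hsub
  have h₂ := Set.ncard_image_le (f := fun v => s(v, parent v)) (Set.toFinite {v | v ≠ r})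
  have h₃ := Set.ncard_add_ncard_compl ({r} : Set V)
  rw [Set.ncard_singleton] at h₃
  have h₄ : ({r} : Set V)ᶜ = {v | v ≠ r} := rfl
  rw [h₄] at h₃
  change G.edgeSet.ncard + 1 ≤ _
  omega

open Classical in
/-- The neighbour of a vertex in the direction of the root. -/
noncomputable def joinParent (r : V) (l : ℕ) (parent : V → V) : JoinVertex V l → JoinVertex V l
  | none => none
  | some (b, Sum.inr j) => pathVertex r l b j
  | some (b, Sum.inl v) => if v = r then pathVertex r l b l else some (b, Sum.inl (parent v))

theorem joinParent_adj {parent : V → V}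
    (h : ∀ v w, G.Adj v w → (v ≠ r ∧ parent v = w) ∨ (w ≠ r ∧ parent w = v)) :
    ∀ v w : JoinVertex V l, (joinTwoCopies G r l).Adj v w →
    (v ≠ none ∧ joinParent r l parent v = w) ∨ (w ≠ none ∧ joinParent r l parent w = v) := by
  refine joinTwoCopies_adj_induction ?_ ?_ ?_
  · exact fun v w h => h.symm
  · intro b j hj
    right
    rcases hj.lt_or_eq with hj | rfl
    · rw [pathVertex_succ hj]
      simp [joinParent]
    · rw [pathVertex_last]
      simp [joinParent]
  · intro b v w hvw
    rcases h v w hvw with ⟨hv, rfl⟩ | ⟨hw, rfl⟩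
    · left
      simp [joinParent, hv]
    · right
      simp [joinParent, hw]

/-- The three branches at the root of the copy `true` of `joinTwoCopies G r l`. -/
def joinBranch {l' : ℕ} : JoinVertex (JoinVertex V l) l' → Option (Fin 3)
  | some (true, Sum.inl none) => none
  | some (true, Sum.inl (some (true, _))) => some 0
  | some (true, Sum.inl (some (false, _))) => some 1
  | _ => some 2

theorem joinBranch_copy_pathVertex {l' : ℕ} (b : Bool) (j : ℕ) :
    joinBranch (l' := l') (some (true, Sum.inl (pathVertex r l b (j + 1)))) =
      some (if b then 0 else 1) := by
  simp only [pathVertex]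
  cases b <;> split_ifs <;> simp_all [joinBranch]

theorem joinBranch_pathVertex {l' : ℕ} {b : Bool} {j : ℕ} (hj : j ≤ l') :
    joinBranch (V := V) (l := l) (pathVertex none l' b j) = some 2 := by
  cases j with
  | zero => rfl
  | succ j =>
    rw [pathVertex_succ hj]
    cases b <;> rfl

/-- The branches at the root of a copy of `joinTwoCopies G r l` in the next tree. -/
def joinThreeBranches (G : SimpleGraph V) (r : V) (l l' : ℕ) :
    ThreeBranches (joinTwoCopies (joinTwoCopies G r l) none l') where
  x := some (true, Sum.inl none)
  branch := joinBranch
  gate := ![some (true, Sum.inl (pathVertex r l true 1)),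
    some (true, Sum.inl (pathVertex r l false 1)), pathVertex none l' true l']
  branch_eq_none := by
    rintro (_ | ⟨_ | _, (_ | ⟨_ | _, _⟩) | _⟩) <;> simp [joinBranch]
  branch_gate j := by
    fin_cases j
    · exact joinBranch_copy_pathVertex true 0
    · exact joinBranch_copy_pathVertex false 0
    · exact joinBranch_pathVertex le_rfl
  adj_gate j := by
    fin_cases j
    · exact joinTwoCopies_adj_copy true (joinTwoCopies_adj_path true (Nat.zero_le l))
    · exact joinTwoCopies_adj_copy true (joinTwoCopies_adj_path false (Nat.zero_le l))
    · have := joinTwoCopies_adj_path (G := joinTwoCopies G r l) (r := none) true (le_refl l')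
      rw [pathVertex_last] at this
      exact this.symm
  branch_of_adj := by
    refine joinTwoCopies_adj_induction ?_ ?_ ?_
    · rintro v w (h | h | h)
      · exact Or.inl h.symm
      · exact Or.inr (Or.inr h)
      · exact Or.inr (Or.inl h)
    · intro b j hj
      rcases hj.lt_or_eq with hj' | rfl
      · exact Or.inl (by rw [joinBranch_pathVertex hj, joinBranch_pathVertex hj'])
      · rw [pathVertex_last]
        cases b
        · exact Or.inl (by rw [joinBranch_pathVertex hj]; rfl)
        · exact Or.inr (Or.inr ⟨rfl, 2, rfl⟩)
    · rintro (_ | _)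
      · exact fun v w _ => Or.inl rfl
      · refine joinTwoCopies_adj_induction ?_ ?_ ?_
        · rintro v w (h | h | h)
          · exact Or.inl h.symm
          · exact Or.inr (Or.inr h)
          · exact Or.inr (Or.inl h)
        · rintro b (_ | j) -
          · cases b
            · exact Or.inr (Or.inl ⟨rfl, 1, rfl⟩)
            · exact Or.inr (Or.inl ⟨rfl, 0, rfl⟩)
          · exact Or.inl (by rw [joinBranch_copy_pathVertex, joinBranch_copy_pathVertex])
        · intro b v w _
          cases b <;> exact Or.inl rfl

/-- Two of the branches at the root of the copy `true` hold its two copies of `G`; the third leads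
through the new root to the copy `false`. Folding twice retracts onto each of the three copies. -/
theorem not_lionClearable_join_join {k l' : ℕ} (hG : G.Connected) (h : ¬ LionClearable G k) :
    ¬ LionClearable (joinTwoCopies (joinTwoCopies G r l) none l') (k + 1) := by
  refine (joinThreeBranches G r l l').not_lionClearable_succ
    (joinTwoCopies_connected (joinTwoCopies_connected hG)) h
    ![fun v => some (true, Sum.inl (some (true, Sum.inl v))),
      fun v => some (true, Sum.inl (some (false, Sum.inl v))),
      fun v => some (false, Sum.inl (some (true, Sum.inl v)))]
    (fun v => joinFold r l (joinFold none l' v)) ?_ ?_ ?_ ?_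
  · intro j a b hab
    fin_cases j <;> exact joinTwoCopies_adj_copy _ (joinTwoCopies_adj_copy _ hab)
  · intro j w
    fin_cases j <;> rfl
  · intro a b hab
    rcases joinFold_adj a b hab with e | e
    · exact Or.inl (by rw [e])
    · exact joinFold_adj _ _ e
  · intro j w
    fin_cases j <;> rfl

theorem not_lionClearable_join {k : ℕ} (h : ¬ LionClearable G k) :
    ¬ LionClearable (joinTwoCopies G r l) k := fun h' =>
  h (h'.of_retract (fun v => some (true, Sum.inl v)) (joinFold r l)
    (fun _ _ hab => joinTwoCopies_adj_copy true hab) joinFold_adj fun _ => rfl)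

end Join

/-! ### Lower bounds for the trees and their supergraphs -/

section Tree

theorem subdividedTree_connected (n : ℕ) : (subdividedTree n).Connected := by
  induction n with
  | zero =>
    have : Nonempty Unit := ⟨()⟩
    exact (SimpleGraph.connected_iff _).2 ⟨fun v w => SimpleGraph.Reachable.refl _, ⟨()⟩⟩
  | succ n ih => exact joinTwoCopies_connected ih

theorem exists_parent_subdividedTree (n : ℕ) : ∃ parent : TreeVertex n → TreeVertex n,
    ∀ v w, (subdividedTree n).Adj v w →
      (v ≠ treeRoot n ∧ parent v = w) ∨ (w ≠ treeRoot n ∧ parent w = v) := by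
  induction n with
  | zero => exact ⟨id, fun _ _ h => h.elim⟩
  | succ n ih =>
    obtain ⟨parent, h⟩ := ih
    exact ⟨joinParent _ _ parent, joinParent_adj h⟩

theorem subdividedTree_isTree (n : ℕ) : (subdividedTree n).IsTree := by
  obtain ⟨parent, h⟩ := exists_parent_subdividedTree n
  exact isTree_of_parent (subdividedTree_connected n) (treeRoot n) parent h

theorem not_lionClearable_subdividedTree_two_mul (k : ℕ) :
    ¬ LionClearable (subdividedTree (2 * k)) k := by
  induction k with
  | zero =>
    have : Nonempty (TreeVertex (2 * 0)) := ⟨treeRoot _⟩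
    exact not_lionClearable_zero
  | succ k ih => exact not_lionClearable_join_join (subdividedTree_connected _) ih

theorem not_lionClearable_subdividedTree {n k : ℕ} (h : 2 * k ≤ n) :
    ¬ LionClearable (subdividedTree n) k := by
  induction n, h using Nat.le_induction with
  | base => exact not_lionClearable_subdividedTree_two_mul k
  | succ n _ ih => exact not_lionClearable_join ih

theorem lt_lionNumber_subdividedTree {n k : ℕ} (h : 2 * k ≤ n) :
    k < lionNumber (subdividedTree n) := by
  by_contra hlt
  exact not_lionClearable_subdividedTree (by omega : 2 * lionNumber (subdividedTree n) ≤ n)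
    (lionClearable_lionNumber _)

theorem not_lionClearable_two_universalTree (n : ℕ) :
    ¬ LionClearable (universalTree (n + 2)) 2 :=
  (joinThreeBranches (subdividedTree n) (treeRoot n) (internalCount n)
    (internalCount (n + 1))).not_lionClearable_two_addUniversal

theorem two_lt_lionNumber_universalTree {n : ℕ} (h : 2 ≤ n) :
    2 < lionNumber (universalTree n) := by
  obtain ⟨n, rfl⟩ := Nat.exists_eq_add_of_le' h
  by_contra hlt
  exact not_lionClearable_two_universalTree n
    ((lionClearable_lionNumber _).mono (by omega))

end Tree

/-! ### Two lions with jumps -/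

section Sweep

variable {V : Type*} {G : SimpleGraph V}

/-- One step of two lions, one of which may jump to an arbitrary vertex, from the positions `p`, `q`
to the positions `p'`, `q'`. If only vertices of `U` are contaminated before the step, then only
vertices of `U'` are contaminated after it. -/
def SweepStep (G : SimpleGraph V) (p q : V) (U : Set V) (p' q' : V) (U' : Set V) : Prop :=
  ((p' = p ∨ G.Adj p p') ∨ (q' = q ∨ G.Adj q q')) ∧
    ∀ v ∈ U, ∀ w, w = v ∨ G.Adj w v →
      w = p' ∨ w = q' ∨ (w = p ∧ v = p') ∨ (w = q ∧ v = q') ∨ w ∈ U'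

/-- A sequence of `n` such steps in which the vertex `r` is never contaminated. -/
inductive Sweep (G : SimpleGraph V) (r : V) : ℕ → V → V → Set V → V → V → Set V → Prop
  | refl {p q : V} {U : Set V} : r ∉ U → Sweep G r 0 p q U p q U
  | step {n : ℕ} {p q p' q' p'' q'' : V} {U U' U'' : Set V} : r ∉ U →
      SweepStep G p q U p' q' U' → Sweep G r n p' q' U' p'' q'' U'' →
      Sweep G r (n + 1) p q U p'' q'' U''

namespace Sweep

variable {r p q p' q' p'' q'' : V} {U U' U'' : Set V} {m n : ℕ}

theorem trans (h : Sweep G r m p q U p' q' U') (h' : Sweep G r n p' q' U' p'' q'' U'') :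
    Sweep G r (m + n) p q U p'' q'' U'' := by
  induction h with
  | refl _ => rwa [zero_add]
  | step hr hs _ ih =>
    rw [Nat.add_right_comm]
    exact .step hr hs (ih h')

theorem single (hU : r ∉ U) (hU' : r ∉ U') (h : SweepStep G p q U p' q' U') :
    Sweep G r 1 p q U p' q' U' :=
  .step hU h (.refl hU')

theorem of_seq (P Q : ℕ → V) (U : ℕ → Set V) (n : ℕ) (hr : ∀ j ≤ n, r ∉ U j)
    (hs : ∀ j < n, SweepStep G (P j) (Q j) (U j) (P (j + 1)) (Q (j + 1)) (U (j + 1))) :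
    Sweep G r n (P 0) (Q 0) (U 0) (P n) (Q n) (U n) := by
  induction n with
  | zero => exact .refl (hr 0 le_rfl)
  | succ n ih =>
    exact (ih (fun j hj => hr j (by omega)) fun j hj => hs j (by omega)).trans
      (.single (hr n (by omega)) (hr (n + 1) le_rfl) (hs n (by omega)))

/-- The final empty state is repeated forever, so that the steps are defined at all times. -/
theorem exists_seq (h : Sweep G r n p q U p' q' U') (hU' : U' = ∅) :
    ∃ (P Q : ℕ → V) (S : ℕ → Set V), P 0 = p ∧ Q 0 = q ∧ S 0 = U ∧ S n = ∅ ∧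
      ∀ t, SweepStep G (P t) (Q t) (S t) (P (t + 1)) (Q (t + 1)) (S (t + 1)) := by
  induction h with
  | @refl p q U _ =>
    exact ⟨fun _ => p, fun _ => q, fun _ => U, rfl, rfl, rfl, hU', fun t =>
      ⟨Or.inl (Or.inl rfl), fun v hv => by simp [hU'] at hv⟩⟩
  | @step n p q _ _ _ _ U _ _ _ hs _ ih =>
    obtain ⟨P, Q, S, rfl, rfl, rfl, hn, hstep⟩ := ih hU'
    refine ⟨fun t => t.casesOn p P, fun t => t.casesOn q Q, fun t => t.casesOn U S,
      rfl, rfl, rfl, hn, fun t => ?_⟩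
    cases t with
    | zero => exact hs
    | succ t => exact hstep t

end Sweep

/-- Three lions on the graph with a universal vertex can imitate two lions on the graph one of which
may jump in each step: the third lion waits on the universal vertex and changes roles with a lion
that jumps. -/
theorem lionClearable_addUniversal_of_seq (P Q : ℕ → V) (S : ℕ → Set V)
    (h₀ : ∀ v, v ≠ P 0 → v ≠ Q 0 → v ∈ S 0)
    (hs : ∀ t, SweepStep G (P t) (Q t) (S t) (P (t + 1)) (Q (t + 1)) (S (t + 1)))
    {n : ℕ} (hn : S n = ∅) : LionClearable (addUniversal G) 3 := by
  classical
  let role : ℕ → Fin 3 → Option V := fun t => ![none, some (P t), some (Q t)]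
  let walkP : ℕ → Prop := fun t => P (t + 1) = P t ∨ G.Adj (P t) (P (t + 1))
  let walkQ : ℕ → Prop := fun t => Q (t + 1) = Q t ∨ G.Adj (Q t) (Q (t + 1))
  -- Role `0` is the waiting lion. A jumper exchanges roles with it by moving to the universal
  -- vertex; this works because at most one lion jumps per step, and the universal vertex stays
  -- occupied.
  let τ : ℕ → Equiv.Perm (Fin 3) := fun t =>
    if walkQ t then (if walkP t then 1 else Equiv.swap 0 1) else Equiv.swap 0 2
  have hwalk : ∀ t, walkP t ∨ walkQ t := fun t => (hs t).1
  have hτP : ∀ t, walkP t → τ t 1 = 1 := by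
    intro t h
    simp only [τ, h, if_true]
    split_ifs
    · rfl
    · decide
  have hτQ : ∀ t, walkQ t → τ t 2 = 2 := by
    intro t h
    simp only [τ, h, if_true]
    split_ifs
    · rfl
    · decide
  have hrole : ∀ t a, role (t + 1) (τ t a) = role t a ∨
      (addUniversal G).Adj (role t a) (role (t + 1) (τ t a)) := by
    intro t a
    by_cases hP : walkP t
    · by_cases hQ : walkQ t
      · have hτ : τ t = 1 := by simp [τ, hP, hQ]
        rw [hτ]
        fin_cases a
        · exact Or.inl rfl
        · exact hP.imp (congrArg some) id
        · exact hQ.imp (congrArg some) id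
      · have hτ : τ t = Equiv.swap 0 2 := by simp [τ, hQ]
        rw [hτ]
        fin_cases a
        · exact Or.inr trivial
        · exact hP.imp (congrArg some) id
        · exact Or.inr trivial
    · have hQ := (hwalk t).resolve_left hP
      have hτ : τ t = Equiv.swap 0 1 := by simp [τ, hP, hQ]
      rw [hτ]
      fin_cases a
      · exact Or.inr trivial
      · exact Or.inr trivial
      · exact hQ.imp (congrArg some) id
  let σ : ℕ → Equiv.Perm (Fin 3) := fun t => Nat.rec 1 (fun t e => τ t * e) t
  have hσ : ∀ t j, σ (t + 1) j = τ t (σ t j) := fun t j => rfl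
  let p : LionPath (addUniversal G) 3 :=
    ⟨fun t j => role t (σ t j), fun t j => by rw [hσ]; exact hrole t (σ t j)⟩
  have hocc : ∀ t a, role t a ∈ p.occupied t := fun t a =>
    ⟨(σ t).symm a, by simp [p]⟩
  have hmoves : ∀ t a, (role t a, role (t + 1) (τ t a)) ∈ p.moves t := fun t a =>
    ⟨(σ t).symm a, by simp [p, hσ]⟩
  have inv : ∀ t, ∀ o ∈ p.contaminated t, ∃ v ∈ S t, o = some v := by
    intro t
    induction t with
    | zero =>
      rintro (_ | v) hv
      · exact absurd (hocc 0 0) hv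
      · refine ⟨v, h₀ v ?_ ?_, rfl⟩
        · rintro rfl
          exact hv (hocc 0 1)
        · rintro rfl
          exact hv (hocc 0 2)
    | succ t ih =>
      intro o ho
      have hno := p.notMem_occupied_of_mem_contaminated ho
      rcases o with _ | w
      · exact absurd (hocc (t + 1) 0) hno
      have hwP : w ≠ P (t + 1) := by
        rintro rfl
        exact hno (hocc (t + 1) 1)
      have hwQ : w ≠ Q (t + 1) := by
        rintro rfl
        exact hno (hocc (t + 1) 2)
      refine ⟨w, ?_, rfl⟩
      rcases p.exists_of_mem_contaminated_succ ho with h | ⟨o, h, hadj, hm, -⟩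
      · obtain ⟨v, hv, hvw⟩ := ih _ h
        obtain rfl := Option.some_inj.1 hvw
        rcases (hs t).2 w hv w (Or.inl rfl) with e | e | ⟨-, e⟩ | ⟨-, e⟩ | e
        · exact absurd e hwP
        · exact absurd e hwQ
        · exact absurd e hwP
        · exact absurd e hwQ
        · exact e
      · obtain ⟨v, hv, rfl⟩ := ih _ h
        have hadj : G.Adj w v := hadj
        rcases (hs t).2 v hv w (Or.inr hadj) with e | e | ⟨rfl, rfl⟩ | ⟨rfl, rfl⟩ | e
        · exact absurd e hwP
        · exact absurd e hwQ
        · have := hmoves t 1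
          rw [hτP t (Or.inr hadj)] at this
          exact absurd this hm
        · have := hmoves t 2
          rw [hτQ t (Or.inr hadj)] at this
          exact absurd this hm
        · exact e
  refine ⟨p, n, Set.eq_empty_iff_forall_notMem.2 fun o ho => ?_⟩
  obtain ⟨v, hv, -⟩ := inv n o ho
  rw [hn] at hv
  exact hv

end Sweep

/-! ### Sweeping the trees recursively -/

section SweepJoin

variable {V : Type} {G : SimpleGraph V} {r : V} {l : ℕ}

/-- The vertices on the side `b` that are separated from the new root by `pathVertex r l b j`. -/
def beyond (r : V) (l : ℕ) (b : Bool) (j : ℕ) : Set (JoinVertex V l)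
  | none => False
  | some (b', Sum.inr i) => b' = b ∧ j ≤ i
  | some (b', Sum.inl v) => b' = b ∧ (j ≤ l ∨ v ≠ r)

theorem none_notMem_beyond (b : Bool) (j : ℕ) : (none : JoinVertex V l) ∉ beyond r l b j := id

theorem copy_mem_beyond {b b' : Bool} {j : ℕ} {v : V} :
    (some (b', Sum.inl v) : JoinVertex V l) ∈ beyond r l b j ↔ b' = b ∧ (j ≤ l ∨ v ≠ r) := Iff.rfl

theorem path_mem_beyond {b b' : Bool} {j : ℕ} {i : Fin l} :
    (some (b', Sum.inr i) : JoinVertex V l) ∈ beyond r l b j ↔ b' = b ∧ j ≤ i := Iff.rfl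

theorem pathVertex_mem_beyond {b b' : Bool} {i j : ℕ} (hi : i ≤ l + 1) :
    pathVertex r l b' i ∈ beyond r l b j ↔ b' = b ∧ j < i := by
  rcases i with _ | i
  · rw [pathVertex_zero]
    simp [none_notMem_beyond]
  · rcases (Nat.le_of_succ_le_succ hi).lt_or_eq with h | rfl
    · rw [pathVertex_succ h, path_mem_beyond, Nat.lt_succ_iff]
    · rw [pathVertex_last, copy_mem_beyond]
      simp

/-- For `j ≤ l` a single edge leaves the set. For `j = l + 1` its boundary is the root of the copy,
which may have several neighbours inside. -/
theorem beyond_adj {b : Bool} {j : ℕ} (hj : j ≤ l + 1) : ∀ v w : JoinVertex V l,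
    (joinTwoCopies G r l).Adj v w →
    (v ∈ beyond r l b j → w ∈ beyond r l b j ∨
      (w = pathVertex r l b j ∧ (j ≤ l → v = pathVertex r l b (j + 1)))) ∧
    (w ∈ beyond r l b j → v ∈ beyond r l b j ∨
      (v = pathVertex r l b j ∧ (j ≤ l → w = pathVertex r l b (j + 1)))) := by
  have copy : ∀ b' v w, some (b', Sum.inl v) ∈ beyond r l b j →
      some (b', Sum.inl w) ∈ beyond r l b j ∨ (some (b', Sum.inl w) = pathVertex r l b j ∧
        (j ≤ l → some (b', Sum.inl v) = pathVertex r l b (j + 1))) := by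
    intro b' v w hv
    rw [copy_mem_beyond] at hv ⊢
    obtain ⟨rfl, -⟩ := hv
    by_cases hjl : j ≤ l
    · exact Or.inl ⟨rfl, Or.inl hjl⟩
    · by_cases hw : w = r
      · obtain rfl : j = l + 1 := by omega
        exact Or.inr ⟨by rw [pathVertex_last, hw], fun h => absurd h hjl⟩
      · exact Or.inl ⟨rfl, Or.inr hw⟩
  refine joinTwoCopies_adj_induction ?_ ?_ ?_
  · exact fun v w h => h.symm
  · intro b' i hi
    rw [pathVertex_mem_beyond (by omega), pathVertex_mem_beyond (by omega)]
    constructor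
    · rintro ⟨rfl, h⟩
      exact Or.inl ⟨rfl, by omega⟩
    · rintro ⟨rfl, h⟩
      rcases (Nat.lt_succ_iff.1 h).lt_or_eq with h | rfl
      · exact Or.inl ⟨rfl, h⟩
      · exact Or.inr ⟨rfl, fun _ => rfl⟩
  · exact fun b' v w _ => ⟨copy b' v w, copy b' w v⟩

theorem beyond_spread {b : Bool} {j : ℕ} (hj : j ≤ l + 1) {v w : JoinVertex V l}
    (hv : v ∈ beyond r l b j) (h : w = v ∨ (joinTwoCopies G r l).Adj w v) :
    w ∈ beyond r l b j ∨ (w = pathVertex r l b j ∧ (j ≤ l → v = pathVertex r l b (j + 1))) := by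
  rcases h with rfl | h
  · exact Or.inl hv
  · exact (beyond_adj hj w v h).2 hv

theorem mem_beyond_succ {b : Bool} {j : ℕ} {v : JoinVertex V l}
    (hv : v ∈ beyond r l b j) : v = pathVertex r l b (j + 1) ∨ v ∈ beyond r l b (j + 1) := by
  rcases v with _ | ⟨b', v | i⟩
  · exact hv.elim
  · obtain ⟨rfl, hv⟩ := hv
    by_cases h : j + 1 ≤ l ∨ v ≠ r
    · exact Or.inr ⟨rfl, h⟩
    · push Not at h
      obtain ⟨h, rfl⟩ := h
      obtain rfl : j = l := by simp at hv; omega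
      exact Or.inl (pathVertex_last b').symm
  · obtain ⟨rfl, hv⟩ := hv
    rcases hv.lt_or_eq with h | rfl
    · exact Or.inr ⟨rfl, h⟩
    · exact Or.inl (pathVertex_succ i.2).symm

theorem beyond_anti {b : Bool} {i j : ℕ} (hij : i ≤ j) : beyond r l b j ⊆ beyond r l b i := by
  rintro (_ | ⟨b', v | m⟩) hv
  · exact hv
  · exact ⟨hv.1, hv.2.imp (fun h => by omega) id⟩
  · exact ⟨hv.1, hij.trans hv.2⟩

theorem beyond_spread_pred {b : Bool} {j : ℕ} (hj : j ≤ l) {v w : JoinVertex V l}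
    (hv : v ∈ beyond r l b (j + 1)) (h : w = v ∨ (joinTwoCopies G r l).Adj w v) :
    w ∈ beyond r l b j := by
  rcases beyond_spread (by omega) hv h with h | ⟨rfl, -⟩
  · exact beyond_anti (by omega) h
  · exact (pathVertex_mem_beyond (by omega)).2 ⟨rfl, by omega⟩

/-- A lion that walks one step along the path pushes the contamination back: the only edge by which
it could escape is the one the lion uses. -/
theorem beyond_walk {b : Bool} {j : ℕ} (hj : j ≤ l) {v w : JoinVertex V l}
    (hv : v ∈ beyond r l b j) (h : w = v ∨ (joinTwoCopies G r l).Adj w v) :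
    w = pathVertex r l b (j + 1) ∨
      (w = pathVertex r l b j ∧ v = pathVertex r l b (j + 1)) ∨ w ∈ beyond r l b (j + 1) := by
  rcases beyond_spread (by omega) hv h with h' | ⟨rfl, h'⟩
  · exact (mem_beyond_succ h').imp id Or.inr
  · exact Or.inr (Or.inl ⟨rfl, h' hj⟩)

theorem exists_copy_of_adj {b : Bool} {v : V} (hv : v ≠ r) {w : JoinVertex V l}
    (h : (joinTwoCopies G r l).Adj w (some (b, Sum.inl v))) :
    ∃ w', G.Adj w' v ∧ w = some (b, Sum.inl w') := by
  rw [joinTwoCopies, SimpleGraph.fromRel_adj] at h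
  obtain ⟨-, h⟩ := h
  rcases w with _ | ⟨b', w | i⟩ <;> simp [joinRel, hv] at h
  rcases h with ⟨rfl, h⟩ | ⟨rfl, h⟩
  · exact ⟨w, h, rfl⟩
  · exact ⟨w, h.symm, rfl⟩

/-- A sweep of `G` as a sweep of a copy of `G`, while the contamination spreads elsewhere. -/
theorem Sweep.lift {n : ℕ} {p q p' q' : V} {U U' : Set V} (h : Sweep G r n p q U p' q' U')
    (b : Bool) (E : ℕ → Set (JoinVertex V l)) (hE : ∀ j ≤ n, none ∉ E j)
    (hE' : ∀ j < n, ∀ v ∈ E j, ∀ w, w = v ∨ (joinTwoCopies G r l).Adj w v → w ∈ E (j + 1)) :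
    Sweep (joinTwoCopies G r l) none n (some (b, Sum.inl p)) (some (b, Sum.inl q))
      ((fun v => some (b, Sum.inl v)) '' U ∪ E 0) (some (b, Sum.inl p')) (some (b, Sum.inl q'))
      ((fun v => some (b, Sum.inl v)) '' U' ∪ E n) := by
  induction h generalizing E with
  | refl _ =>
    refine .refl ?_
    rintro (⟨v, -, hv⟩ | hv)
    · cases hv
    · exact hE 0 le_rfl hv
  | @step n p q p' q' p'' q'' U U' U'' hr hs _ ih =>
    refine .step ?_ ⟨?_, ?_⟩ (ih (fun j => E (j + 1)) (fun j hj => hE (j + 1) (by omega))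
      fun j hj => hE' (j + 1) (by omega))
    · rintro (⟨v, -, hv⟩ | hv)
      · cases hv
      · exact hE 0 (by omega) hv
    · exact hs.1.imp (Or.imp (fun e => by rw [e]) (joinTwoCopies_adj_copy b))
        (Or.imp (fun e => by rw [e]) (joinTwoCopies_adj_copy b))
    · rintro _ (⟨v, hv, rfl⟩ | hv) w hw
      · obtain ⟨w', hw', rfl⟩ : ∃ w', (w' = v ∨ G.Adj w' v) ∧ w = some (b, Sum.inl w') := by
          rcases hw with rfl | hw
          · exact ⟨v, Or.inl rfl, rfl⟩
          · obtain ⟨w', hw', rfl⟩ := exists_copy_of_adj (by rintro rfl; exact hr hv) hw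
            exact ⟨w', Or.inr hw', rfl⟩
        rcases hs.2 v hv w' hw' with rfl | rfl | ⟨rfl, rfl⟩ | ⟨rfl, rfl⟩ | h
        · exact Or.inl rfl
        · exact Or.inr (Or.inl rfl)
        · exact Or.inr (Or.inr (Or.inl ⟨rfl, rfl⟩))
        · exact Or.inr (Or.inr (Or.inr (Or.inl ⟨rfl, rfl⟩)))
        · exact Or.inr (Or.inr (Or.inr (Or.inr (Or.inl ⟨w', h, rfl⟩))))
      · exact Or.inr (Or.inr (Or.inr (Or.inr (Or.inr (hE' 0 (by omega) _ hv w hw)))))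

theorem mem_copy_of_mem_beyond {b : Bool} {p₀ : V} {w : JoinVertex V l}
    (hw : w ∈ beyond r l b (l + 1)) :
    w = some (b, Sum.inl p₀) ∨ w ∈ (fun v => some (b, Sum.inl v)) '' ({r, p₀}ᶜ : Set V) := by
  rcases w with _ | ⟨b', w | i⟩
  · exact hw.elim
  · obtain ⟨rfl, hw⟩ := hw
    have hw : w ≠ r := hw.resolve_left (by omega)
    by_cases h : w = p₀
    · exact Or.inl (by rw [h])
    · exact Or.inr ⟨w, by simp [hw, h], rfl⟩
  · have := hw.2
    omega

/-- If `G` can be swept from a position with a lion on the root `r`, then two copies of `G` joined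
by paths that are long enough can be swept from the new root: two lions clear the two paths, one of
them jumps so that they clear the first copy, then one jumps to the new root, clears the path to the
second copy again, and finally they clear the second copy. -/
theorem Sweep.join {n : ℕ} {p₀ p q : V} (h : Sweep G r n r p₀ {r, p₀}ᶜ p q ∅) (hn : n ≤ l) :
    ∃ p' q', Sweep (joinTwoCopies G r l) none (2 * l + 2 * n + 5) none none {none, none}ᶜ
      p' q' ∅ := by
  have hnone : ∀ b j, (none : JoinVertex V l) ∉ beyond r l b j := none_notMem_beyond
  have hcopy : ∀ (b : Bool) (A : Set V),
      (none : JoinVertex V l) ∉ (fun v => some (b, Sum.inl v)) '' A := by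
    rintro b A ⟨v, -, hv⟩
    cases hv
  have h₁ := Sweep.of_seq (G := joinTwoCopies G r l) (r := none) (pathVertex r l true)
    (pathVertex r l false) (fun j => beyond r l true j ∪ beyond r l false j) (l + 1)
    (fun j _ hj => hj.elim (hnone _ _) (hnone _ _)) (fun j hj => by
      refine ⟨Or.inl (Or.inr (joinTwoCopies_adj_path true (by omega))), ?_⟩
      rintro v (hv | hv) w hw
      · rcases beyond_walk (by omega) hv hw with h | h | h
        · exact Or.inl h
        · exact Or.inr (Or.inr (Or.inl h))
        · exact Or.inr (Or.inr (Or.inr (Or.inr (Or.inl h))))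
      · rcases beyond_walk (by omega) hv hw with h | h | h
        · exact Or.inr (Or.inl h)
        · exact Or.inr (Or.inr (Or.inr (Or.inl h)))
        · exact Or.inr (Or.inr (Or.inr (Or.inr (Or.inr h)))))
  -- The lion of side `false` jumps to `p₀`, which lets the contamination out onto that path. The
  -- index `l - 0` is the start of the family used in `h₃`.
  have h₂ : Sweep (joinTwoCopies G r l) none 1 (pathVertex r l true (l + 1))
      (pathVertex r l false (l + 1)) (beyond r l true (l + 1) ∪ beyond r l false (l + 1))
      (some (true, Sum.inl r)) (some (true, Sum.inl p₀))
      ((fun v => some (true, Sum.inl v)) '' {r, p₀}ᶜ ∪ beyond r l false (l - 0)) := by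
    refine .single (fun hj => hj.elim (hnone _ _) (hnone _ _))
      (fun hj => hj.elim (hcopy _ _) (hnone _ _)) ⟨Or.inl (Or.inl (pathVertex_last _).symm), ?_⟩
    rintro v (hv | hv) w hw
    · rcases beyond_spread le_rfl hv hw with h | ⟨rfl, -⟩
      · rcases mem_copy_of_mem_beyond h with h | h
        · exact Or.inr (Or.inl h)
        · exact Or.inr (Or.inr (Or.inr (Or.inr (Or.inl h))))
      · exact Or.inl (pathVertex_last _)
    · exact Or.inr (Or.inr (Or.inr (Or.inr (Or.inr (beyond_spread_pred le_rfl hv hw)))))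
  -- Meanwhile the contamination gains one path vertex per step; by `n ≤ l` the subtraction is never
  -- truncated, and the new root is not reached.
  have h₃ := h.lift (l := l) true (fun j => beyond r l false (l - j)) (fun j _ => hnone _ _)
    (fun j hj v hv w hw => by
      rw [show l - j = l - (j + 1) + 1 by omega] at hv
      exact beyond_spread_pred (by omega) hv hw)
  -- One lion jumps to the new root just in time; the whole of side `false` is now counted as
  -- contaminated.
  have h₄ : Sweep (joinTwoCopies G r l) none 1 (some (true, Sum.inl p)) (some (true, Sum.inl q))
      ((fun v => some (true, Sum.inl v)) '' ∅ ∪ beyond r l false (l - n))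
      (pathVertex r l false 0) (some (true, Sum.inl q)) (beyond r l false 0) := by
    refine .single (fun hj => hj.elim (hcopy _ _) (hnone _ _)) (hnone _ _)
      ⟨Or.inr (Or.inl rfl), ?_⟩
    rintro v (⟨_, hv, -⟩ | hv) w hw
    · exact hv.elim
    · rcases beyond_spread (by omega) (beyond_anti (Nat.zero_le _) hv) hw with h | ⟨h, -⟩
      · exact Or.inr (Or.inr (Or.inr (Or.inr h)))
      · exact Or.inl h
  have h₅ := Sweep.of_seq (G := joinTwoCopies G r l) (r := none) (pathVertex r l false)
    (fun _ => some (true, Sum.inl q)) (beyond r l false) (l + 1)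
    (fun j _ => hnone _ _) (fun j hj => by
      refine ⟨Or.inr (Or.inl rfl), fun v hv w hw => ?_⟩
      rcases beyond_walk (by omega) hv hw with h | h | h
      · exact Or.inl h
      · exact Or.inr (Or.inr (Or.inl h))
      · exact Or.inr (Or.inr (Or.inr (Or.inr h))))
  have h₆ : Sweep (joinTwoCopies G r l) none 1 (pathVertex r l false (l + 1))
      (some (true, Sum.inl q)) (beyond r l false (l + 1))
      (some (false, Sum.inl r)) (some (false, Sum.inl p₀))
      ((fun v => some (false, Sum.inl v)) '' {r, p₀}ᶜ ∪ ∅) := by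
    refine .single (hnone _ _) (fun hj => hj.elim (hcopy _ _) id)
      ⟨Or.inl (Or.inl (pathVertex_last _).symm), fun v hv w hw => ?_⟩
    rcases beyond_spread le_rfl hv hw with h | ⟨rfl, -⟩
    · rcases mem_copy_of_mem_beyond h with h | h
      · exact Or.inr (Or.inl h)
      · exact Or.inr (Or.inr (Or.inr (Or.inr (Or.inl h))))
    · exact Or.inl (pathVertex_last _)
  have h₇ := h.lift (l := l) false (fun _ => ∅) (fun _ _ => id) (fun _ _ v hv => hv.elim)
  have hall := h₁.trans (h₂.trans (h₃.trans (h₄.trans (h₅.trans (h₆.trans h₇)))))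
  have hU : beyond r l true 0 ∪ beyond r l false 0 = ({none, none}ᶜ : Set (JoinVertex V l)) := by
    ext v
    rcases v with _ | ⟨_ | _, v | i⟩ <;> simp [none_notMem_beyond, copy_mem_beyond, path_mem_beyond]
  rw [hU, Set.image_empty, Set.empty_union,
    show l + 1 + (1 + (n + (1 + (l + 1 + (1 + n))))) = 2 * l + 2 * n + 5 by omega] at hall
  exact ⟨_, _, hall⟩

theorem exists_sweep_subdividedTree (n : ℕ) : ∃ p₀ p q,
    Sweep (subdividedTree (n + 1)) (treeRoot (n + 1)) (stepCount (n + 1)) (treeRoot (n + 1)) p₀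
      {treeRoot (n + 1), p₀}ᶜ p q ∅ := by
  induction n with
  | zero =>
    have hadj : ∀ b, (subdividedTree 1).Adj none (some (b, Sum.inl ())) := by
      intro b
      have := joinTwoCopies_adj_path (G := subdividedTree 0) (r := treeRoot 0) b (le_refl 0)
      rwa [pathVertex_last] at this
    -- In `T₁` only the leaf `false` is contaminated at first: the lion on the root steps onto it
    -- while the one on the other leaf moves to the root.
    refine ⟨some (true, Sum.inl ()), some (false, Sum.inl ()), none,
      .single (by simp) id ⟨Or.inl (Or.inr (hadj false)), ?_⟩⟩
    rintro (_ | ⟨_ | _, ⟨⟩ | i⟩) hv w hw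
    · exact absurd (Or.inl rfl) hv
    · rcases w with _ | ⟨_ | _, ⟨⟩ | i⟩
      · exact Or.inr (Or.inl rfl)
      · exact Or.inl rfl
      · exact i.elim0
      · exact Or.inr (Or.inr (Or.inr (Or.inl ⟨rfl, by
          rcases hw with hw | hw
          · cases hw
          · rw [subdividedTree, joinTwoCopies, SimpleGraph.fromRel_adj] at hw
            simp [joinRel] at hw⟩)))
      · exact i.elim0
    · exact i.elim0
    · exact absurd (Or.inr rfl) hv
    · exact i.elim0
  | succ n ih =>
    obtain ⟨p₀, p, q, h⟩ := ih
    obtain ⟨p', q', h'⟩ := h.join (l := internalCount (n + 1)) (by simp [internalCount])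
    refine ⟨none, p', q', ?_⟩
    -- With `l = t + 5` and `n = t` the duration `2l + 2n + 5` is `4t + 15`, the recursion for
    -- `stepCount`.
    rw [show 2 * internalCount (n + 1) + 2 * stepCount (n + 1) + 5 = stepCount (n + 2) by
      simp only [internalCount, stepCount]; omega] at h'
    exact h'

theorem lionClearable_universalTree {n : ℕ} (h : 1 ≤ n) : LionClearable (universalTree n) 3 := by
  obtain ⟨n, rfl⟩ := Nat.exists_eq_add_of_le' h
  obtain ⟨p₀, p, q, hs⟩ := exists_sweep_subdividedTree n
  obtain ⟨P, Q, S, hP, hQ, hS, hn, hstep⟩ := hs.exists_seq rfl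
  refine lionClearable_addUniversal_of_seq P Q S (fun v h₁ h₂ => ?_) hstep hn
  rw [hS, ← hP, ← hQ]
  simp [h₁, h₂]

theorem lionNumber_universalTree_le {n : ℕ} (h : 1 ≤ n) : lionNumber (universalTree n) ≤ 3 :=
  Nat.sInf_le (lionClearable_universalTree h)

end SweepJoin

/-! ### Conclusion -/

section Main

theorem subdividedTree_isContained_universalTree (n : ℕ) :
    (subdividedTree n).IsContained (universalTree n) :=
  ⟨⟨⟨some, fun h => h⟩, Option.some_injective _⟩⟩

theorem SimpleGraph.Iso.lionNumber_le {V W : Type*} [Finite W] {G : SimpleGraph V}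
    {H : SimpleGraph W} (e : G ≃g H) : lionNumber G ≤ lionNumber H :=
  Nat.sInf_le ((lionClearable_lionNumber H).of_retract e e.symm (fun _ _ h => e.map_rel_iff.2 h)
    (fun _ _ h => Or.inr (e.symm.map_rel_iff.2 h)) e.symm_apply_apply)

theorem lionNumber_universalTree {n : ℕ} (h : 2 ≤ n) : lionNumber (universalTree n) = 3 :=
  le_antisymm (lionNumber_universalTree_le (by omega)) (two_lt_lionNumber_universalTree h)

theorem three_lt_lionNumber_subdividedTree {n : ℕ} (h : 6 < n) :
    3 < lionNumber (subdividedTree n) :=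
  lt_lionNumber_subdividedTree (by omega)

theorem ceil_half_le_lionNumber_subdividedTree (n : ℕ) :
    ⌈(n : ℚ) / 2⌉₊ ≤ lionNumber (subdividedTree n) := by
  -- Taking `k = ⌊n/2⌋` gives at least `⌊n/2⌋ + 1`, which is at least `⌈n/2⌉`.
  have h := lt_lionNumber_subdividedTree (Nat.mul_div_le n 2)
  refine Nat.ceil_le.2 ?_
  rw [div_le_iff₀ two_pos]
  exact_mod_cast (by omega : n ≤ lionNumber (subdividedTree n) * 2)

end Main

theorem mainTheorem6 :
    -- the lion number is not monotone under subgraph inclusion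
    (¬ ∀ (V : Type) (_ : Finite V) (G : SimpleGraph V) (H : G.Subgraph),
      lionNumber H.coe ≤ lionNumber G) ∧
    -- the trees `Tᵢ` and their supergraphs `Gᵢ`
    (∀ i : ℕ, 1 ≤ i →
      (subdividedTree i).IsTree ∧
      (subdividedTree i).IsContained (universalTree i) ∧
      lionNumber (universalTree i) ≤ 3 ∧
      ⌈(i : ℚ) / 2⌉₊ ≤ lionNumber (subdividedTree i)) ∧
    (∀ i : ℕ, 2 ≤ i → lionNumber (universalTree i) = 3) ∧
    (∀ i : ℕ, 6 < i →
      lionNumber (universalTree i) = 3 ∧ 3 < lionNumber (subdividedTree i)) := by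
  refine ⟨fun hmono => ?_, fun i hi => ⟨subdividedTree_isTree i,
    subdividedTree_isContained_universalTree i, lionNumber_universalTree_le hi,
    ceil_half_le_lionNumber_subdividedTree i⟩, fun i hi => lionNumber_universalTree hi,
    fun i hi => ⟨lionNumber_universalTree (by omega), three_lt_lionNumber_subdividedTree hi⟩⟩
  obtain ⟨c⟩ := subdividedTree_isContained_universalTree 7
  have h₁ := hmono _ inferInstance (universalTree 7) c.toSubgraph
  have h₂ := c.isoToSubgraph.lionNumber_le
  have h₃ := three_lt_lionNumber_subdividedTree (le_refl 7)
  rw [lionNumber_universalTree (by omega)] at h₁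
  omega
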